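/- Let $d\ge 1$ and $\beta>0$. Let $\mathcal C_0:\mathbb R^d\to\mathbb R$ be an autocorrelation function with integrable real power spectral density $\hat{\mathcal C}_0\in L^1(\mathbb R^d)$, i.e. $\mathcal C_0(\mathbf x)=(2\pi)^{-d}\int \hat{\mathcal C}_0(\mathbf u)e^{i\mathbf u\cdot\mathbf x}\,d\mathbf u$. For each $\alpha>0$ let $\mathcal V^R=\mathcal V^{R,\alpha}(\zeta,\mathbf q,\mathbf r,\mathbf s)$, $\zeta\ge 0$, $\mathbf q,\mathbf r,\mathbf s\in\mathbb R^d$, be the solution of $$\begin{aligned}\frac{\partial\mathcal V^R}{\partial\zeta}=\frac{\beta}{(2\pi)^d}\int\hat{\mathcal C}_0(\mathbf u)\Big[&\mathcal V^R(\zeta,\mathbf q-\tfrac12\mathbf u,\mathbf r-\mathbf u,\mathbf s)e^{-i\alpha\mathbf s\cdot\mathbf u\zeta}+\mathcal V^R(\zeta,\mathbf q-\tfrac12\mathbf u,\mathbf r+\mathbf u,\mathbf s)e^{i\alpha\mathbf s\cdot\mathbf u\zeta}\\&+\mathcal V^R(\zeta,\mathbf q-\tfrac12\mathbf u,\mathbf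 r,\mathbf s-\mathbf u)e^{-i\alpha\mathbf r\cdot\mathbf u\zeta}+\mathcal V^R(\zeta,\mathbf q-\tfrac12\mathbf u,\mathbf r,\mathbf s+\mathbf u)e^{i\alpha\mathbf r\cdot\mathbf u\zeta}-2\mathcal V^R(\zeta,\mathbf q,\mathbf r,\mathbf s)\\&-\mathcal V^R(\zeta,\mathbf q-\tfrac12\mathbf u,\mathbf r-\mathbf u,\mathbf s+\mathbf u)e^{i\alpha[(\mathbf r-\mathbf s)\cdot\mathbf u-|\mathbf u|^2]\zeta}\\&-\mathcal V^R(\zeta,\mathbf q-\tfrac12\mathbf u,\mathbf r-\mathbf u,\mathbf s-\mathbf u)e^{-i\alpha[(\mathbf r+\mathbf s)\cdot\mathbf u+|\mathbf u|^2]\zeta}\Big]d\mathbf u\end{aligned}$$ with $\mathcal V^R(0,\mathbf q,\mathbf r,\mathbf s)=\delta(\mathbf q)$. Here a solution is a family $\mathcal V^R(\zeta,d\mathbf q,\mathbf r,\mathbf s)$ of finite complex measures in $\mathbf q$, measurable in $(\mathbf r,\mathbf s)$, with total variation bounded uniformly in $(\mathbf r,\mathbf s)$ and locally uniformly in $\zeta$,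 that satisfies the equation for every $(\zeta,\mathbf r,\mathbf s)$ when integrated in $\mathbf q$ against any bounded continuous function. For $\mathbf r\in\mathbb R^d$ and $\zeta\ge0$ let $$\mathcal V^R_{\mathbf r}(\zeta,\mathbf q)=\frac1{(2\pi)^d}\int e^{-i\mathbf q\cdot\mathbf u}\exp\Big(\beta\int_0^\zeta\big[\mathcal C_0(\tfrac{\mathbf u}2+\mathbf r\zeta')+\mathcal C_0(\tfrac{\mathbf u}2-\mathbf r\zeta')-2\mathcal C_0(\mathbf 0)\big]d\zeta'\Big)d\mathbf u,$$ understood as a tempered distribution in $\mathbf q$. Then, for every $\zeta\ge0$ and with convergence in the sense of tempered distributions in $\mathbf q$ as $\alpha\to\infty$: (1) for any $\mathbf r\ne\mathbf 0$ and $\mathbf s\ne\mathbf 0$, $\ \mathcal V^R(\zeta,\mathbf q,\mathbf r,\mathbf s)\to\delta(\mathbf q)e^{-2\beta\mathcal C_0(\mathbf 0)\zeta}$; (2) for any $\mathbf r$, the distribution $\mathcal V^R_{\mathbf r}$ solves $$\frac{\partial\mathcal V^R_{\mathbf r}}{\partial\zeta}=\frac{2\beta}{(2\pi)^d}\int\hat{\mathcal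 C}_0(\mathbf u)\big[\mathcal V^R_{\mathbf r}(\zeta,\mathbf q-\tfrac12\mathbf u)\cos(\mathbf r\cdot\mathbf u\,\zeta)-\mathcal V^R_{\mathbf r}(\zeta,\mathbf q)\big]d\mathbf u,\qquad \mathcal V^R_{\mathbf r}(0,\mathbf q)=\delta(\mathbf q);$$ for any $\mathbf r$ and any $\mathbf s\ne\mathbf 0$, $\ \mathcal V^R(\zeta,\mathbf q,\tfrac{\mathbf r}\alpha,\mathbf s)\to\mathcal V^R_{\mathbf r}(\zeta,\mathbf q)$; and for any $\mathbf r\ne\mathbf 0$ and any $\mathbf s$, $\ \mathcal V^R(\zeta,\mathbf q,\mathbf r,\tfrac{\mathbf s}\alpha)\to\mathcal V^R_{\mathbf s}(\zeta,\mathbf q)$; (3) for any $\mathbf r$ and $\mathbf s$, $\ \mathcal V^R(\zeta,\mathbf q,\tfrac{\mathbf r}\alpha,\tfrac{\mathbf s}\alpha)\to\mathcal V^R_{\mathbf r}(\zeta,\mathbf q)+\mathcal V^R_{\mathbf s}(\zeta,\mathbf q)-\delta(\mathbf q)e^{-2\beta\mathcal C_0(\mathbf 0)\zeta}$. -/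

import Mathlib

open MeasureTheory Filter Topology
open scoped SchwartzMap BoundedContinuousFunction RealInnerProductSpace NNReal

noncomputable section

namespace ReflectedWigner

/-- The transverse space `ℝ^d` with its Euclidean structure. -/
abbrev Sp (d : ℕ) : Type := EuclideanSpace ℝ (Fin d)

/-- The unimodular phase `e^{iθ}`. -/
def phase (θ : ℝ) : ℂ := Complex.exp ((θ : ℂ) * Complex.I)

/-- The pairing `∫ ψ(q) μ(dq)` of a finite complex measure `μ` on `ℝ^d` with a function `ψ`. -/
def pairing {d : ℕ} (μ : ComplexMeasure (Sp d)) (ψ : Sp d → ℂ) : ℂ :=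
  μ.integral ψ (ContinuousLinearMap.mul ℝ ℂ)

/-- Testing `T(q - u/2)` against `ψ(q)` is testing `T(q)` against `ψ(q + u/2)`:
this is the translated test function `q ↦ ψ(q + u/2)`. -/
def halfShift {d : ℕ} (u : Sp d) (ψ : Sp d → ℂ) : Sp d → ℂ :=
  fun q => ψ (q + (1 / 2 : ℝ) • u)

/-- `C₀` is the autocorrelation function with integrable power spectral density `Ĉ₀`:
`C₀(x) = (2π)^{-d} ∫ Ĉ₀(u) e^{i u·x} du`. -/
structure IsSpectralDensity {d : ℕ} (C₀ Chat₀ : Sp d → ℝ) : Prop where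
  integrable : Integrable Chat₀
  inversion : ∀ x : Sp d,
    (C₀ x : ℂ) = (((2 * Real.pi) ^ d)⁻¹ : ℝ) * ∫ u : Sp d, (Chat₀ u : ℂ) * phase ⟪u, x⟫

/-- The right-hand side of the dimensionless integro-differential system, at time `ζ` and at the
point `(r, s)`, tested in the variable `q` against `ψ`.  Here `W r s` is the (complex) measure
`𝒱(ζ, dq, r, s)`. -/
def systemRHS {d : ℕ} (α β : ℝ) (Chat₀ : Sp d → ℝ) (ζ : ℝ)
    (W : Sp d → Sp d → ComplexMeasure (Sp d)) (r s : Sp d) (ψ : Sp d → ℂ) : ℂ :=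
  ((β / (2 * Real.pi) ^ d : ℝ) : ℂ) * ∫ u : Sp d, (Chat₀ u : ℂ) *
    ( pairing (W (r - u) s) (halfShift u ψ) * phase (-(α * ⟪s, u⟫ * ζ))
    + pairing (W (r + u) s) (halfShift u ψ) * phase (α * ⟪s, u⟫ * ζ)
    + pairing (W r (s - u)) (halfShift u ψ) * phase (-(α * ⟪r, u⟫ * ζ))
    + pairing (W r (s + u)) (halfShift u ψ) * phase (α * ⟪r, u⟫ * ζ)
    - 2 * pairing (W r s) ψ
    - pairing (W (r - u) (s + u)) (halfShift u ψ) * phase (α * (⟪r - s, u⟫ - ‖u‖ ^ 2) * ζ)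
    - pairing (W (r - u) (s - u)) (halfShift u ψ)
        * phase (-(α * (⟪r + s, u⟫ + ‖u‖ ^ 2) * ζ)) )

/-- `V ζ r s`, for `ζ ≥ 0` and `r, s ∈ ℝ^d`, is a measure-valued solution (in the variable `q`) of
the dimensionless system with initial condition `δ(q)`: a measurable family of finite complex
measures whose total variation is bounded uniformly in `(r, s)` and locally uniformly in `ζ`, and
which satisfies the system at every `(ζ, r, s)` when tested against bounded continuous
functions of `q`. -/
structure IsSolution {d : ℕ} (α β : ℝ) (Chat₀ : Sp d → ℝ)
    (V : ℝ → Sp d → Sp d → ComplexMeasure (Sp d)) : Prop where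
  initial : ∀ r s : Sp d, V 0 r s = VectorMeasure.dirac 0 (1 : ℂ)
  measurable : ∀ ζ : ℝ, 0 ≤ ζ → ∀ A : Set (Sp d), MeasurableSet A →
    Measurable fun p : Sp d × Sp d => V ζ p.1 p.2 A
  bounded : ∀ Z : ℝ, ∃ M : ℝ≥0, ∀ ζ : ℝ, 0 ≤ ζ → ζ ≤ Z → ∀ r s : Sp d,
    (V ζ r s).variation Set.univ ≤ M
  equation : ∀ (ψ : Sp d →ᵇ ℂ) (r s : Sp d) (ζ : ℝ), 0 ≤ ζ →
    HasDerivWithinAt (fun ζ' : ℝ => pairing (V ζ' r s) ψ)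
      (systemRHS α β Chat₀ ζ (V ζ) r s ψ) (Set.Ici 0) ζ

/-- The function
`u ↦ exp(β ∫₀^ζ [C₀(u/2 + rζ') + C₀(u/2 - rζ') - 2 C₀(0)] dζ')`. -/
def layerSymbol {d : ℕ} (β : ℝ) (C₀ : Sp d → ℝ) (r : Sp d) (ζ : ℝ) (u : Sp d) : ℝ :=
  Real.exp (β * ∫ t in (0 : ℝ)..ζ,
    (C₀ ((1 / 2 : ℝ) • u + t • r) + C₀ ((1 / 2 : ℝ) • u - t • r) - 2 * C₀ 0))

/-- The explicit layer profile
`𝒱_r(ζ, q) = (2π)^{-d} ∫ e^{-i q·u} exp(β ∫₀^ζ [C₀(u/2 + rζ') + C₀(u/2 - rζ') - 2 C₀(0)] dζ') du`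
as a tempered distribution in `q`, evaluated at the test function `ψ`.  The `u`-integral does not
converge absolutely for fixed `q`, so, as always for such a formula, the test function is
integrated in `q` first. -/
def layer {d : ℕ} (β : ℝ) (C₀ : Sp d → ℝ) (r : Sp d) (ζ : ℝ) (ψ : Sp d → ℂ) : ℂ :=
  (((2 * Real.pi) ^ d)⁻¹ : ℝ) *
    ∫ u : Sp d, (∫ q : Sp d, phase (-⟪q, u⟫) * ψ q) * (layerSymbol β C₀ r ζ u : ℂ)

/-- The distribution-valued function `U` of `ζ ≥ 0` solves, in the sense of tempered distributions
in `q`, the equation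
`∂U/∂ζ = 2β (2π)^{-d} ∫ Ĉ₀(u) [U(ζ, q - u/2) cos(r·u ζ) - U(ζ, q)] du` with `U(0, q) = δ(q)`. -/
structure IsLayerSolution {d : ℕ} (β : ℝ) (Chat₀ : Sp d → ℝ) (r : Sp d)
    (U : ℝ → (Sp d → ℂ) → ℂ) : Prop where
  initial : ∀ ψ : 𝓢(Sp d, ℂ), U 0 ψ = ψ 0
  equation : ∀ (ψ : 𝓢(Sp d, ℂ)) (ζ : ℝ), 0 ≤ ζ →
    HasDerivWithinAt (fun ζ' : ℝ => U ζ' ψ)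
      (((2 * β / (2 * Real.pi) ^ d : ℝ) : ℂ) * ∫ u : Sp d, (Chat₀ u : ℂ) *
        (U ζ (halfShift u ψ) * (Real.cos (⟪r, u⟫ * ζ) : ℂ) - U ζ ψ))
      (Set.Ici 0) ζ

end ReflectedWigner

end

/-!
The limit is computed one Fourier mode in `q` at a time. Testing the system against `e^{i k·q}` turns
the half shifts into factors `e^{i k·u/2}`, so that the mode, with the loss `e^{-2βC₀(0)ζ}` divided
out, solves an exchange system on bounded functions of `(r, s)`: six channels, each moving `(r, s)` by
multiples of `u` with an integrable weight and a phase whose rate is proportional to `α`. Such a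
system has bounds that do not depend on `α` (`IsMode.norm_le`), hence its solutions are Lipschitz in
time uniformly in `α`.

Seen at `(r + r₁/α, s + s₁/α)`, the phase of a channel either rotates at a rate tending to infinity
for almost every `u`, and then the channel contributes nothing in the limit
(`tendsto_integral_amplitude_of_not_resonant`), or it does not depend on `α` at all. The latter,
resonant, case occurs only for the shifts of `r` when `s = 0` and for the shifts of `s` when `r = 0`.
The limit therefore solves the integral equation with the resonant channels only. The distance to the
solution of that equation satisfies a Volterra inequality in the limit, and an exponentially weighted
bound on it can be halved indefinitely (`eventually_norm_sub_le_step`,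
`tendsto_of_isResonantSolution`).

The resonant equation is solved explicitly (`isResonantSolution_limitMode`): almost every shift
leaves the other layer, so in a single layer the equation is a scalar linear differential equation
whose solution is the exponential in the layer profile, and at `r = s = 0` the two layers add up.
All parts of the theorem are the cases of one formula, `tendsto_pairing`. The passage from modes to
Schwartz test functions is Fourier inversion and dominated convergence in the frequency; it uses that
a finite complex measure has a density with respect to its variation. The equation of the layer
profile follows by differentiating its Fourier integral (`isLayerSolution_layer`).
-/

namespace ReflectedWigner

open Set

variable {d : ℕ}

/-! ### Phases -/

@[fun_prop]
lemma continuous_phase : Continuous phase := by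
  unfold phase; fun_prop

@[simp]
lemma norm_phase (θ : ℝ) : ‖phase θ‖ = 1 := by
  simp [phase, Complex.norm_exp_ofReal_mul_I]

lemma phase_add (x y : ℝ) : phase (x + y) = phase x * phase y := by
  simp [phase, add_mul, Complex.exp_add]

@[simp]
lemma phase_zero : phase 0 = 1 := by simp [phase]

lemma hasDerivAt_phase_mul (lam t : ℝ) :
    HasDerivAt (fun τ : ℝ => phase (lam * τ)) (phase (lam * t) * (lam * Complex.I)) t := by
  unfold phase
  have h1 : HasDerivAt (fun τ : ℝ => ((lam * τ : ℝ) : ℂ) * Complex.I) (lam * Complex.I) t := by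
    have := ((hasDerivAt_id t).const_mul lam).ofReal_comp.mul_const Complex.I
    simpa using this
  exact h1.cexp

/-- An integral of a Lipschitz amplitude against a phase of rate `lam` is `O(1 / |lam|)`. -/
lemma norm_integral_mul_phase_le {g g' : ℝ → ℂ} {T M M' lam : ℝ} (hT : 0 ≤ T) (hg : Continuous g)
    (hg' : ∀ t ∈ Ico 0 T, HasDerivWithinAt g (g' t) (Ici t) t)
    (hM : ∀ t ∈ Icc 0 T, ‖g t‖ ≤ M) (hM' : ∀ t ∈ Ico 0 T, ‖g' t‖ ≤ M') (hlam : lam ≠ 0) :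
    ‖∫ t in (0 : ℝ)..T, g t * phase (lam * t)‖ ≤ (2 * M + M' * T) / |lam| := by
  have hI : ((lam : ℂ) * Complex.I) ≠ 0 := by simp [hlam]
  have hnI : ‖((lam : ℂ) * Complex.I)‖ = |lam| := by simp
  have hcont : Continuous fun t => g t * phase (lam * t) := by fun_prop
  set h : ℝ → ℂ := fun t => g t * phase (lam * t) / (lam * Complex.I) with hh
  set H : ℝ → ℂ := fun x => h x - ∫ t in (0 : ℝ)..x, g t * phase (lam * t) with hH
  have hHd : ∀ t ∈ Ico 0 T,
      HasDerivWithinAt H (g' t * phase (lam * t) / (lam * Complex.I)) (Ici t) t := by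
    intro t ht
    have h1 := (((hg' t ht).mul (hasDerivAt_phase_mul lam t).hasDerivWithinAt).div_const
      ((lam : ℂ) * Complex.I))
    have h2 := (hcont.integral_hasStrictDerivAt 0 t).hasDerivAt.hasDerivWithinAt (s := Ici t)
    refine (h1.sub h2).congr_deriv ?_
    rw [add_div, ← mul_assoc (g t), mul_div_cancel_right₀ _ hI]
    ring
  have hHc : ContinuousOn H (Icc 0 T) := by
    have : Continuous H := by
      have h2 : Continuous fun x => ∫ t in (0 : ℝ)..x, g t * phase (lam * t) :=
        intervalIntegral.continuous_primitive (fun a b => hcont.intervalIntegrable a b) 0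
      have h3 : Continuous h := by
        simp only [hh]; exact hcont.div_const _
      exact h3.sub h2
    exact this.continuousOn
  have hb := norm_image_sub_le_of_norm_deriv_right_le_segment (C := M' / |lam|) hHc hHd
    (by
      intro t ht
      rw [norm_div, norm_mul, norm_phase, mul_one, hnI]
      gcongr
      exact hM' t ht) T ⟨hT, le_rfl⟩
  have e : ∫ t in (0 : ℝ)..T, g t * phase (lam * t) = h T - h 0 - (H T - H 0) := by
    simp [hH]
  have hhb : ∀ t ∈ Icc 0 T, ‖h t‖ ≤ M / |lam| := by
    intro t ht
    simp only [hh]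
    rw [norm_div, norm_mul, norm_phase, mul_one, hnI]
    gcongr
    exact hM t ht
  rw [e]
  calc _ ≤ ‖h T‖ + ‖h 0‖ + ‖H T - H 0‖ := (norm_sub_le _ _).trans (by gcongr; exact norm_sub_le _ _)
    _ ≤ M / |lam| + M / |lam| + M' / |lam| * (T - 0) := by
        gcongr
        · exact hhb T ⟨hT, le_rfl⟩
        · exact hhb 0 ⟨le_rfl, hT⟩
    _ = _ := by ring

/-! ### Non-resonant directions -/

/-- Unless `a = 0` and `c = 0`, the set where `a · u + c |u|²` vanishes is a hyperplane or a sphere,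
hence Lebesgue null. -/
lemma ae_inner_add_mul_norm_sq_ne_zero (hd : 0 < d) (a : Sp d) (c : ℝ) (h : a ≠ 0 ∨ c ≠ 0) :
    ∀ᵐ u : Sp d, ⟪a, u⟫ + c * ‖u‖ ^ 2 ≠ 0 := by
  rw [ae_iff]
  simp only [not_not]
  by_cases hc : c = 0
  · have ha : a ≠ 0 := by tauto
    have := Measure.addHaar_submodule (volume : Measure (Sp d)) (LinearMap.ker (innerₛₗ ℝ a))
      (by
        intro htop
        have : a ∈ LinearMap.ker (innerₛₗ ℝ a) := by rw [htop]; trivial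
        simp at this
        exact ha this)
    convert this using 2
    ext u
    simp [hc]
  · have : Nonempty (Fin d) := ⟨⟨0, hd⟩⟩
    have : Nontrivial (Sp d) := inferInstance
    have := Measure.addHaar_sphere (volume : Measure (Sp d)) (-(2 * c)⁻¹ • a) (‖(2 * c)⁻¹ • a‖)
    refine measure_mono_null ?_ this
    intro u hu
    simp only [mem_ofPred_eq] at hu
    rw [mem_sphere_iff_norm, ← sq_eq_sq₀ (norm_nonneg _) (norm_nonneg _)]
    rw [neg_smul, sub_neg_eq_add, norm_add_sq_real, inner_smul_right, real_inner_comm]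
    have : ‖u‖ ^ 2 = - ⟪a, u⟫ / c := by field_simp; linarith
    rw [this]; field_simp; ring

lemma ae_add_smul_ne_zero (hd : 0 < d) (r : Sp d) {a : ℝ} (ha : a ≠ 0) :
    ∀ᵐ u : Sp d, r + a • u ≠ 0 := by
  have : Nonempty (Fin d) := ⟨⟨0, hd⟩⟩
  have : Nontrivial (Sp d) := inferInstance
  rw [ae_iff]
  simp only [not_not]
  refine measure_mono_null (t := {(-a⁻¹) • r}) ?_ (measure_singleton _)
  intro u hu
  simp only [mem_ofPred_eq] at hu
  rw [mem_singleton_iff, eq_neg_of_add_eq_zero_left hu]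
  simp [smul_smul, ha]

/-! ### Exchange systems on bounded functions of `(r, s)` -/

/-- One term `e ∫ w(u) g(r + a u, s + b u) e^{iα(b r·u + a s·u + c|u|²)t} du` of an exchange
system; the signed weight `e` is at most one in absolute value. -/
structure Channel where
  /-- The multiple of `u` added to `r`. -/
  a : ℝ
  /-- The multiple of `u` added to `s`. -/
  b : ℝ
  /-- The coefficient of `|u|²` in the phase. -/
  c : ℝ
  /-- The signed weight of the term. -/
  e : ℝ
  abs_e_le : |e| ≤ 1

variable {ι : Type*} [Fintype ι]

/-- The coefficient of `α t` in the phase of a channel. -/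
noncomputable def Channel.rate (k : Channel) (r s u : Sp d) : ℝ :=
  k.b * ⟪r, u⟫ + k.a * ⟪s, u⟫ + k.c * ‖u‖ ^ 2

/-- The integrand of a channel acting on a function `g` of `(r, s)`. -/
noncomputable def Channel.integrand (k : Channel) (w : Sp d → ℂ) (α t : ℝ) (g : Sp d → Sp d → ℂ)
    (r s u : Sp d) : ℂ :=
  k.e * (w u * (g (r + k.a • u) (s + k.b • u) * phase (α * k.rate r s u * t)))

/-- A bounded solution `f t r s`, with initial value `1`, of the exchange system
`∂f/∂t = ∑ⱼ ∫ (integrand of channel j) du` at parameter `α`.  The time `t` ranges over `ℝ`, but only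
`t ≥ 0` is constrained by the equation. -/
structure IsMode (ch : ι → Channel) (w : Sp d → ℂ) (α : ℝ) (f : ℝ → Sp d → Sp d → ℂ) : Prop where
  initial : ∀ r s, f 0 r s = 1
  continuous : ∀ r s, Continuous fun t => f t r s
  measurable : ∀ t, Measurable fun p : Sp d × Sp d => f t p.1 p.2
  bounded : ∀ Z : ℝ, ∃ M : ℝ, ∀ t ∈ Icc 0 Z, ∀ r s, ‖f t r s‖ ≤ M
  equation : ∀ r s t, 0 ≤ t → HasDerivWithinAt (fun τ => f τ r s)
    (∑ j, ∫ u, (ch j).integrand w α t (f t) r s u) (Ici t) t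

/-- A growth rate dominating the right-hand side of an exchange system; the added `1` makes it
positive. -/
noncomputable def growth (ι : Type*) [Fintype ι] (w : Sp d → ℂ) : ℝ :=
  Fintype.card ι * (∫ u, ‖w u‖) + 1

lemma growth_pos (w : Sp d → ℂ) : 0 < growth ι w := by
  unfold growth
  have : 0 ≤ ∫ u, ‖w u‖ := integral_nonneg fun _ => norm_nonneg _
  positivity

lemma Channel.norm_integrand_le (k : Channel) (w : Sp d → ℂ) (α t : ℝ) {g : Sp d → Sp d → ℂ}
    {M : ℝ} (hg : ∀ r s, ‖g r s‖ ≤ M) (r s u : Sp d) :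
    ‖k.integrand w α t g r s u‖ ≤ ‖w u‖ * M := by
  unfold Channel.integrand
  simp only [norm_mul, norm_phase, mul_one, Complex.norm_real, Real.norm_eq_abs]
  calc |k.e| * (‖w u‖ * ‖g (r + k.a • u) (s + k.b • u)‖)
      ≤ 1 * (‖w u‖ * M) := by gcongr; exacts [k.abs_e_le, hg _ _]
    _ = _ := one_mul _

lemma norm_sum_integral_integrand_le (ch : ι → Channel) {w : Sp d → ℂ} (hw : Integrable w) (α t : ℝ)
    {g : Sp d → Sp d → ℂ} {M : ℝ} (hg : ∀ r s, ‖g r s‖ ≤ M) (r s : Sp d) :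
    ‖∑ j, ∫ u, (ch j).integrand w α t g r s u‖ ≤ growth ι w * M := by
  have hM : 0 ≤ M := (norm_nonneg _).trans (hg 0 0)
  calc _ ≤ ∑ _j : ι, (∫ u, ‖w u‖) * M := by
        refine norm_sum_le_of_le _ fun j _ => ?_
        rw [← integral_mul_const]
        exact norm_integral_le_of_norm_le (hw.norm.mul_const _)
          (.of_forall fun u => (ch j).norm_integrand_le w α t hg r s u)
    _ = (Fintype.card ι * (∫ u, ‖w u‖)) * M := by
        rw [Finset.sum_const, Finset.card_univ, nsmul_eq_mul, mul_assoc]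
    _ ≤ _ := by
        unfold growth; gcongr; linarith

namespace IsMode

variable {ch : ι → Channel} {w : Sp d → ℂ} {α : ℝ} {f : ℝ → Sp d → Sp d → ℂ}

/-- An exponential bound for a mode improves itself. -/
lemma norm_le_step (hf : IsMode ch w α f) (hw : Integrable w) {Z B : ℝ}
    (hB : ∀ t ∈ Icc 0 Z, ∀ r s, ‖f t r s‖ ≤ B * Real.exp (2 * growth ι w * t)) :
    ∀ t ∈ Icc 0 Z, ∀ r s, ‖f t r s‖ ≤ (1 + B / 2) * Real.exp (2 * growth ι w * t) := by
  intro t ht r s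
  have hK := growth_pos (ι := ι) w
  have hB0 : 0 ≤ B := by
    have := (norm_nonneg _).trans (hB t ht 0 0)
    exact nonneg_of_mul_nonneg_left this (Real.exp_pos _)
  -- comparison function: the rate `2 K` in the exponent gains a factor `1 / 2` on integration
  have hE : ∀ x : ℝ, HasDerivAt (fun x => 1 + B / 2 * (Real.exp (2 * growth ι w * x) - 1))
      (growth ι w * (B * Real.exp (2 * growth ι w * x))) x := by
    intro x
    have := (((((hasDerivAt_id x).const_mul (2 * growth ι w)).exp).sub_const 1).const_mul
      (B / 2)).const_add 1
    refine this.congr_deriv ?_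
    simp; ring
  have := image_norm_le_of_norm_deriv_right_le_deriv_boundary (f := fun τ => f τ r s) (a := 0)
    (b := Z) (hf.continuous r s).continuousOn (fun x hx => hf.equation r s x hx.1)
    (by simp [hf.initial]) hE
    (fun x hx => norm_sum_integral_integrand_le ch hw α x (hB x ⟨hx.1, hx.2.le⟩) r s) ht
  refine this.trans ?_
  have h1 : 1 ≤ Real.exp (2 * growth ι w * t) := Real.one_le_exp (by have := ht.1; positivity)
  nlinarith

/-- The mode is bounded uniformly in `α`, by iterating `norm_le_step`. -/
lemma norm_le (hf : IsMode ch w α f) (hw : Integrable w) {t : ℝ} (ht : 0 ≤ t) (r s : Sp d) :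
    ‖f t r s‖ ≤ 2 * Real.exp (2 * growth ι w * t) := by
  obtain ⟨M, hM⟩ := hf.bounded t
  have hM0 : 0 ≤ M := (norm_nonneg _).trans (hM t ⟨ht, le_rfl⟩ 0 0)
  have key : ∀ n : ℕ, ∀ τ ∈ Icc 0 t, ∀ r s,
      ‖f τ r s‖ ≤ (2 + M / 2 ^ n) * Real.exp (2 * growth ι w * τ) := by
    intro n
    induction n with
    | zero =>
      intro τ hτ r s
      have h1 : 1 ≤ Real.exp (2 * growth ι w * τ) :=
        Real.one_le_exp (by have := hτ.1; have := growth_pos (ι := ι) w; positivity)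
      have := hM τ hτ r s
      simp only [pow_zero, div_one]
      nlinarith
    | succ n ih =>
      intro τ hτ r s
      refine (hf.norm_le_step hw ih τ hτ r s).trans (le_of_eq ?_)
      rw [pow_succ]; field_simp; ring
  have hlim : Tendsto (fun n : ℕ => (2 + M / 2 ^ n) * Real.exp (2 * growth ι w * t)) atTop
      (𝓝 ((2 + 0) * Real.exp (2 * growth ι w * t))) := by
    refine Tendsto.mul_const _ (Tendsto.const_add _ ?_)
    exact tendsto_const_nhds.div_atTop (tendsto_pow_atTop_atTop_of_one_lt (by norm_num))
  rw [add_zero] at hlim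
  exact ge_of_tendsto' hlim fun n => key n t ⟨ht, le_rfl⟩ r s

lemma norm_le_of_le (hf : IsMode ch w α f) (hw : Integrable w) {t Z : ℝ} (ht : t ∈ Icc 0 Z)
    (r s : Sp d) : ‖f t r s‖ ≤ 2 * Real.exp (2 * growth ι w * Z) := by
  refine (hf.norm_le hw ht.1 r s).trans ?_
  have := growth_pos (ι := ι) w
  gcongr
  exact ht.2

lemma measurable_uncurry (hf : IsMode ch w α f) :
    Measurable fun p : ℝ × Sp d × Sp d => f p.1 p.2.1 p.2.2 :=
  measurable_uncurry_of_continuous_of_measurable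
    (u := fun t (p : Sp d × Sp d) => f t p.1 p.2) (fun p => hf.continuous p.1 p.2) hf.measurable

end IsMode

/-- Lebesgue measure on `ℝ^d × (0, t]`, over which the exchange system is integrated. -/
noncomputable def slab (d : ℕ) (t : ℝ) : Measure (Sp d × ℝ) :=
  (volume : Measure (Sp d)).prod (volume.restrict (Ioc 0 t))

instance (t : ℝ) : SFinite (slab d t) := by unfold slab; infer_instance

lemma ae_slab_mem (t : ℝ) : ∀ᵐ p ∂(slab d t), p.2 ∈ Ioc 0 t :=
  Measure.quasiMeasurePreserving_snd.ae (ae_restrict_mem measurableSet_Ioc)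

lemma ae_slab_of_ae {t : ℝ} {P : Sp d → Prop} (h : ∀ᵐ u, P u) : ∀ᵐ p ∂(slab d t), P p.1 :=
  Measure.quasiMeasurePreserving_fst.ae h

lemma integrable_slab_norm {w : Sp d → ℂ} (hw : Integrable w) (t : ℝ) :
    Integrable (fun p : Sp d × ℝ => ‖w p.1‖) (slab d t) := by
  have : Integrable (fun _ : ℝ => (1 : ℝ)) (volume.restrict (Ioc 0 t)) := integrable_const _
  simpa [slab] using hw.norm.mul_prod this

lemma integrable_slab_mul {w : Sp d → ℂ} (hw : Integrable w) (t : ℝ) {h : Sp d × ℝ → ℂ} {M : ℝ}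
    (hm : AEStronglyMeasurable h (slab d t)) (hM : ∀ᵐ p ∂(slab d t), ‖h p‖ ≤ M) :
    Integrable (fun p : Sp d × ℝ => w p.1 * h p) (slab d t) := by
  refine Integrable.mono' ((integrable_slab_norm hw t).mul_const M) ?_ ?_
  · exact (hw.aestronglyMeasurable.comp_quasiMeasurePreserving
      Measure.quasiMeasurePreserving_fst).mul hm
  · filter_upwards [hM] with p hp
    rw [norm_mul]; gcongr

namespace Channel

@[fun_prop]
lemma measurable_rate (k : Channel) (r s : Sp d) : Measurable fun u => k.rate r s u := by
  unfold Channel.rate; fun_prop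

/-- The amplitude of a channel, as a function of `(u, t)`. -/
noncomputable def amplitude (k : Channel) (α : ℝ) (f : ℝ → Sp d → Sp d → ℂ) (r s : Sp d) (p : Sp d × ℝ) : ℂ :=
  f p.2 (r + k.a • p.1) (s + k.b • p.1) * phase (α * k.rate r s p.1 * p.2)

lemma measurable_amplitude (k : Channel) (α : ℝ) {f : ℝ → Sp d → Sp d → ℂ}
    (hf : Measurable fun p : ℝ × Sp d × Sp d => f p.1 p.2.1 p.2.2) (r s : Sp d) :
    Measurable (k.amplitude α f r s) := by
  unfold amplitude
  refine Measurable.mul (hf.comp (f := fun p : Sp d × ℝ =>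
    (p.2, r + k.a • p.1, s + k.b • p.1)) (by fun_prop)) ?_
  refine continuous_phase.measurable.comp ?_
  exact (measurable_const.mul ((k.measurable_rate r s).comp measurable_fst)).mul measurable_snd

@[simp]
lemma norm_amplitude (k : Channel) (α : ℝ) (f : ℝ → Sp d → Sp d → ℂ) (r s : Sp d) (p : Sp d × ℝ) :
    ‖k.amplitude α f r s p‖ = ‖f p.2 (r + k.a • p.1) (s + k.b • p.1)‖ := by
  simp [amplitude]

end Channel

namespace IsMode

variable {ch : ι → Channel} {w : Sp d → ℂ} {α : ℝ} {f : ℝ → Sp d → Sp d → ℂ}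

lemma integrable_amplitude (hf : IsMode ch w α f) (hw : Integrable w) (k : Channel) (t : ℝ)
    (r s : Sp d) :
    Integrable (fun p : Sp d × ℝ => w p.1 * k.amplitude α f r s p) (slab d t) := by
  refine integrable_slab_mul hw t (k.measurable_amplitude α hf.measurable_uncurry r s
    ).aestronglyMeasurable (M := 2 * Real.exp (2 * growth ι w * t)) ?_
  filter_upwards [ae_slab_mem t] with p hp
  rw [Channel.norm_amplitude]
  exact hf.norm_le_of_le hw ⟨hp.1.le, hp.2⟩ _ _

/-- Integrated form of the exchange system. -/
lemma duhamel (hf : IsMode ch w α f) (hw : Integrable w) {t : ℝ} (ht : 0 ≤ t) (r s : Sp d) :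
    f t r s = 1 + ∑ j, ((ch j).e : ℂ) *
      ∫ p, w p.1 * (ch j).amplitude α f r s p ∂(slab d t) := by
  have hint : ∀ j, Integrable (fun p : Sp d × ℝ => (ch j).integrand w α p.2 (f p.2) r s p.1)
      (slab d t) := fun j => (hf.integrable_amplitude hw (ch j) t r s).const_mul _
  have hj : ∀ j, IntervalIntegrable (fun τ => ∫ u, (ch j).integrand w α τ (f τ) r s u)
      volume 0 t := by
    intro j
    rw [intervalIntegrable_iff_integrableOn_Ioc_of_le ht]
    exact (hint j).integral_prod_right
  have hsum : IntervalIntegrable (fun τ => ∑ j, ∫ u, (ch j).integrand w α τ (f τ) r s u)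
      volume 0 t := by
    have := IntervalIntegrable.sum (μ := volume) (a := 0) (b := t) Finset.univ
      (f := fun j τ => ∫ u, (ch j).integrand w α τ (f τ) r s u) fun j _ => hj j
    refine this.congr ?_
    intro τ _
    simp
  have h := intervalIntegral.integral_eq_sub_of_hasDeriv_right (f := fun τ => f τ r s) (a := 0)
    (b := t) (hf.continuous r s).continuousOn
    (fun x hx => (hf.equation r s x (by
      rw [min_eq_left ht] at hx; exact hx.1.le)).mono Ioi_subset_Ici_self) hsum
  rw [intervalIntegral.integral_finsetSum fun j _ => hj j] at h
  rw [hf.initial] at h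
  rw [← sub_eq_iff_eq_add', ← h]
  refine Finset.sum_congr rfl fun j _ => ?_
  rw [intervalIntegral.integral_of_le ht, ← integral_const_mul]
  exact (integral_prod_symm _ (hint j)).symm

end IsMode

/-! ### The limit of large `α` for exchange systems -/

/-- The part of the phase of a channel that survives at `(r₁/α, s₁/α)`. -/
noncomputable def Channel.drift (k : Channel) (r₁ s₁ u : Sp d) : ℝ := k.b * ⟪r₁, u⟫ + k.a * ⟪s₁, u⟫

/-- A channel is resonant at `(r, s)` if the coefficient of `α` in its phase vanishes for all
`u`. -/
def Channel.Resonant (k : Channel) (r s : Sp d) : Prop := k.c = 0 ∧ k.b • r + k.a • s = 0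

lemma Channel.mul_rate (k : Channel) {α : ℝ} (hα : 0 < α) (r s r₁ s₁ u : Sp d) :
    α * k.rate (r + α⁻¹ • r₁) (s + α⁻¹ • s₁) u =
      α * (⟪k.b • r + k.a • s, u⟫ + k.c * ‖u‖ ^ 2) + k.drift r₁ s₁ u := by
  simp only [Channel.rate, Channel.drift, inner_add_left, real_inner_smul_left]
  field_simp
  ring

lemma Channel.Resonant.mul_rate {k : Channel} {r s : Sp d} (h : k.Resonant r s) {α : ℝ}
    (hα : 0 < α) (r₁ s₁ u : Sp d) :
    α * k.rate (r + α⁻¹ • r₁) (s + α⁻¹ • s₁) u = k.drift r₁ s₁ u := by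
  rw [k.mul_rate hα, h.1, h.2]; simp

@[fun_prop]
lemma Channel.continuous_drift (k : Channel) (r₁ s₁ : Sp d) :
    Continuous fun u => k.drift r₁ s₁ u := by
  unfold Channel.drift; fun_prop

/-- The contribution of a non-resonant channel vanishes as `α → ∞`: its amplitude is Lipschitz in
time uniformly in `α`, while its phase rotates at a rate tending to infinity for almost
every `u`. -/
lemma tendsto_integral_amplitude_of_not_resonant (hd : 0 < d) {ch : ι → Channel} {w : Sp d → ℂ}
    (hw : Integrable w) {f : ℝ → ℝ → Sp d → Sp d → ℂ} (hf : ∀ α, 0 < α → IsMode ch w α (f α))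
    (k : Channel) {r s : Sp d} (hk : ¬ k.Resonant r s) (r₁ s₁ : Sp d) {t : ℝ} (ht : 0 ≤ t) :
    Tendsto (fun α => ∫ p, w p.1 * k.amplitude α (f α) (r + α⁻¹ • r₁) (s + α⁻¹ • s₁) p ∂(slab d t))
      atTop (𝓝 0) := by
  set M := 2 * Real.exp (2 * growth ι w * t) with hM
  have hpos : ∀ᶠ α : ℝ in atTop, 0 < α := eventually_gt_atTop 0
  have hint : ∀ α, 0 < α → Integrable
      (fun p : Sp d × ℝ => w p.1 * k.amplitude α (f α) (r + α⁻¹ • r₁) (s + α⁻¹ • s₁) p) (slab d t) :=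
    fun α hα => (hf α hα).integrable_amplitude hw k t _ _
  have hprod : (fun α => ∫ p, w p.1 *
        k.amplitude α (f α) (r + α⁻¹ • r₁) (s + α⁻¹ • s₁) p ∂(slab d t)) =ᶠ[atTop]
      fun α => ∫ u, ∫ τ in Ioc 0 t,
        w u * k.amplitude α (f α) (r + α⁻¹ • r₁) (s + α⁻¹ • s₁) (u, τ) := by
    filter_upwards [hpos] with α hα
    exact integral_prod _ (hint α hα)
  rw [tendsto_congr' hprod]
  have hzero : (0 : ℂ) = ∫ _u : Sp d, (0 : ℂ) := by simp
  rw [hzero]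
  refine tendsto_integral_filter_of_dominated_convergence (fun u => ‖w u‖ * M * t) ?_ ?_
    ((hw.norm.mul_const _).mul_const _) ?_
  · filter_upwards [hpos] with α hα
    exact (hint α hα).integral_prod_left.aestronglyMeasurable
  · filter_upwards [hpos] with α hα
    refine .of_forall fun u => ?_
    have := norm_setIntegral_le_of_norm_le_const (μ := (volume : Measure ℝ)) (s := Ioc 0 t)
      (f := fun τ => w u * k.amplitude α (f α) (r + α⁻¹ • r₁) (s + α⁻¹ • s₁) (u, τ))
      (C := ‖w u‖ * M) (by simp) (by
        intro τ hτ
        rw [norm_mul, Channel.norm_amplitude]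
        gcongr
        exact (hf α hα).norm_le_of_le hw ⟨hτ.1.le, hτ.2⟩ _ _)
    simpa [Measure.real, ht] using this
  · have hne : k.b • r + k.a • s ≠ 0 ∨ k.c ≠ 0 := by
      unfold Channel.Resonant at hk; tauto
    filter_upwards [ae_inner_add_mul_norm_sq_ne_zero hd _ _ hne] with u hu
    set η := ⟪k.b • r + k.a • s, u⟫ + k.c * ‖u‖ ^ 2
    set lam : ℝ → ℝ := fun α => α * η + k.drift r₁ s₁ u with hlam
    have habs : Tendsto (fun α => |lam α|) atTop atTop := by
      rcases lt_or_gt_of_ne hu with h | h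
      · refine tendsto_abs_atBot_atTop.comp ?_
        exact tendsto_atBot_add_const_right _ _ (tendsto_id.atTop_mul_const_of_neg h)
      · refine tendsto_abs_atTop_atTop.comp ?_
        exact tendsto_atTop_add_const_right _ _ (tendsto_id.atTop_mul_const h)
    have hb : Tendsto (fun α => ‖w u‖ * ((2 * M + growth ι w * M * t) / |lam α|)) atTop
        (𝓝 (‖w u‖ * 0)) := (tendsto_const_nhds.div_atTop habs).const_mul _
    rw [mul_zero] at hb
    refine squeeze_zero_norm' ?_ hb
    filter_upwards [hpos, habs.eventually_gt_atTop 0] with α hα hl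
    rw [integral_const_mul, norm_mul]
    gcongr
    rw [← intervalIntegral.integral_of_le ht]
    have hα' := hf α hα
    have := norm_integral_mul_phase_le (T := t) (lam := lam α) ht
      (hα'.continuous (r + α⁻¹ • r₁ + k.a • u) (s + α⁻¹ • s₁ + k.b • u))
      (fun τ hτ => hα'.equation _ _ τ hτ.1)
      (fun τ hτ => hα'.norm_le_of_le hw hτ _ _)
      (fun τ hτ => norm_sum_integral_integrand_le ch hw α τ
        (fun r s => hα'.norm_le_of_le hw ⟨hτ.1, hτ.2.le⟩ r s) _ _)
      (abs_pos.mp hl)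
    simpa only [Channel.amplitude, k.mul_rate hα, hlam] using this

lemma integral_slab_norm_mul_exp_le (w : Sp d → ℂ) {t K B : ℝ} (ht : 0 ≤ t)
    (hK : 0 < K) (hB : 0 ≤ B) :
    ∫ p, ‖w p.1‖ * (B * Real.exp (2 * K * p.2)) ∂(slab d t) ≤
      (∫ u, ‖w u‖) * (B * (Real.exp (2 * K * t) / (2 * K))) := by
  have h0 : 0 ≤ ∫ u, ‖w u‖ := integral_nonneg fun _ => norm_nonneg _
  unfold slab
  rw [integral_prod_mul (fun u => ‖w u‖) (fun τ => B * Real.exp (2 * K * τ)), integral_const_mul,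
    ← intervalIntegral.integral_of_le ht, intervalIntegral.integral_comp_mul_left _ (by positivity),
    integral_exp]
  gcongr
  simp only [mul_zero, Real.exp_zero, smul_eq_mul]
  rw [inv_mul_eq_div]
  gcongr
  linarith

section Limit

variable {ch : ι → Channel} {w : Sp d → ℂ} {f : ℝ → ℝ → Sp d → Sp d → ℂ} {r₁ s₁ : Sp d}
  {φ : ℝ → Sp d → Sp d → ℂ}

open scoped Classical in
/-- The integral equation satisfied by the limit: only resonant channels contribute. -/
def IsResonantSolution (ch : ι → Channel) (w : Sp d → ℂ) (r₁ s₁ : Sp d)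
    (φ : ℝ → Sp d → Sp d → ℂ) : Prop :=
  ∀ t, 0 ≤ t → ∀ r s, φ t r s = 1 + ∑ j, ((ch j).e : ℂ) * (if (ch j).Resonant r s then
    ∫ p, w p.1 * (φ p.2 (r + (ch j).a • p.1) (s + (ch j).b • p.1) *
      phase ((ch j).drift r₁ s₁ p.1 * p.2)) ∂(slab d t) else 0)

/-- A resonant channel propagates an asymptotic bound on the distance to the limit. -/
lemma eventually_norm_integral_sub_le_of_resonant (hw : Integrable w)
    (hf : ∀ α, 0 < α → IsMode ch w α (f α))
    (hφm : Measurable fun p : ℝ × Sp d × Sp d => φ p.1 p.2.1 p.2.2) {t B Mφ : ℝ} (ht : 0 ≤ t)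
    (hB : 0 ≤ B) (hφb : ∀ τ ∈ Icc 0 t, ∀ r s, ‖φ τ r s‖ ≤ Mφ)
    (h : ∀ τ ∈ Icc 0 t, ∀ r s, ∀ δ > 0, ∀ᶠ α in atTop,
      ‖f α τ (r + α⁻¹ • r₁) (s + α⁻¹ • s₁) - φ τ r s‖ ≤
        B * Real.exp (2 * growth ι w * τ) + δ)
    (k : Channel) {r s : Sp d} (hk : k.Resonant r s) {δ : ℝ} (hδ : 0 < δ) :
    ∀ᶠ α in atTop, ‖(∫ p, w p.1 *
        k.amplitude α (f α) (r + α⁻¹ • r₁) (s + α⁻¹ • s₁) p ∂(slab d t)) -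
      ∫ p, w p.1 * (φ p.2 (r + k.a • p.1) (s + k.b • p.1) *
        phase (k.drift r₁ s₁ p.1 * p.2)) ∂(slab d t)‖ ≤
      (∫ u, ‖w u‖) * (B * (Real.exp (2 * growth ι w * t) / (2 * growth ι w))) + δ := by
  have hKpos := growth_pos (ι := ι) w
  set K := growth ι w with hK
  have hpos : ∀ᶠ α : ℝ in atTop, 0 < α := eventually_gt_atTop 0
  set D : ℝ → Sp d × ℝ → ℂ := fun α p =>
    f α p.2 (r + k.a • p.1 + α⁻¹ • r₁) (s + k.b • p.1 + α⁻¹ • s₁) -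
      φ p.2 (r + k.a • p.1) (s + k.b • p.1) with hD
  -- the part of the distance that exceeds the asymptotic bound
  set E : ℝ → Sp d × ℝ → ℝ := fun α p => max (‖D α p‖ - B * Real.exp (2 * K * p.2)) 0 with hE
  have hDm : ∀ α, 0 < α → Measurable (D α) := by
    intro α hα
    refine Measurable.sub ?_ ?_
    · exact (hf α hα).measurable_uncurry.comp (f := fun p : Sp d × ℝ =>
        (p.2, r + k.a • p.1 + α⁻¹ • r₁, s + k.b • p.1 + α⁻¹ • s₁)) (by fun_prop)
    · exact hφm.comp (f := fun p : Sp d × ℝ =>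
        (p.2, r + k.a • p.1, s + k.b • p.1)) (by fun_prop)
  have hEm : ∀ α, 0 < α → Measurable (E α) := fun α hα =>
    ((hDm α hα).norm.sub (by fun_prop)).max measurable_const
  set M := 2 * Real.exp (2 * K * t) + Mφ with hM
  have hM0 : 0 ≤ Mφ := (norm_nonneg _).trans (hφb 0 ⟨le_rfl, ht⟩ 0 0)
  have hDb : ∀ α, 0 < α → ∀ p : Sp d × ℝ, p.2 ∈ Ioc 0 t → ‖D α p‖ ≤ M := by
    intro α hα p hp
    refine (norm_sub_le _ _).trans (add_le_add ?_ ?_)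
    · exact (hf α hα).norm_le_of_le hw ⟨hp.1.le, hp.2⟩ _ _
    · exact hφb _ ⟨hp.1.le, hp.2⟩ _ _
  have hEb : ∀ α, 0 < α → ∀ p : Sp d × ℝ, p.2 ∈ Ioc 0 t → ‖E α p‖ ≤ M := by
    intro α hα p hp
    rw [Real.norm_of_nonneg (le_max_right _ _)]
    refine max_le ?_ (by positivity)
    have := hDb α hα p hp
    have : 0 ≤ B * Real.exp (2 * K * p.2) := by positivity
    linarith
  have hwm : AEStronglyMeasurable (fun p : Sp d × ℝ => ‖w p.1‖) (slab d t) :=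
    (integrable_slab_norm hw t).aestronglyMeasurable
  have hEint : ∀ α, 0 < α → Integrable (fun p : Sp d × ℝ => ‖w p.1‖ * E α p) (slab d t) := by
    intro α hα
    refine Integrable.mono' ((integrable_slab_norm hw t).mul_const M)
      (hwm.mul (hEm α hα).aestronglyMeasurable) ?_
    filter_upwards [ae_slab_mem t] with p hp
    rw [norm_mul, norm_norm]
    gcongr
    exact hEb α hα p hp
  have hElim : Tendsto (fun α => ∫ p, ‖w p.1‖ * E α p ∂(slab d t)) atTop (𝓝 0) := by
    have hzero : (0 : ℝ) = ∫ _p : Sp d × ℝ, (0 : ℝ) ∂(slab d t) := by simp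
    rw [hzero]
    refine tendsto_integral_filter_of_dominated_convergence (fun p => ‖w p.1‖ * M) ?_ ?_
      ((integrable_slab_norm hw t).mul_const M) ?_
    · filter_upwards [hpos] with α hα using (hEint α hα).aestronglyMeasurable
    · filter_upwards [hpos] with α hα
      filter_upwards [ae_slab_mem t] with p hp
      rw [norm_mul, norm_norm]
      gcongr
      exact hEb α hα p hp
    · filter_upwards [ae_slab_mem t] with p hp
      have : Tendsto (fun α => E α p) atTop (𝓝 0) := by
        rw [Metric.tendsto_nhds]
        intro ε hε
        filter_upwards [h p.2 ⟨hp.1.le, hp.2⟩ (r + k.a • p.1) (s + k.b • p.1) (ε / 2) (by positivity)]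
          with α hα
        rw [Real.dist_eq, sub_zero, abs_of_nonneg (le_max_right _ _)]
        refine max_lt ?_ hε
        simp only [hD]
        linarith
      simpa using this.const_mul ‖w p.1‖
  have hexp : Integrable (fun p : Sp d × ℝ => ‖w p.1‖ * (B * Real.exp (2 * K * p.2)))
      (slab d t) := by
    refine hw.norm.mul_prod (g := fun τ => B * Real.exp (2 * K * τ)) ?_
    exact (Continuous.integrableOn_Ioc (by fun_prop))
  filter_upwards [hpos, hElim.eventually_le_const hδ] with α hα hEα
  have hφint : Integrable (fun p : Sp d × ℝ => w p.1 * (φ p.2 (r + k.a • p.1) (s + k.b • p.1) *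
        phase (k.drift r₁ s₁ p.1 * p.2))) (slab d t) := by
    refine integrable_slab_mul hw t (M := Mφ) ?_ ?_
    · refine (Measurable.mul ?_ ?_).aestronglyMeasurable
      · exact hφm.comp (f := fun p : Sp d × ℝ =>
          (p.2, r + k.a • p.1, s + k.b • p.1)) (by fun_prop)
      · exact Continuous.measurable (by fun_prop)
    · filter_upwards [ae_slab_mem t] with p hp
      simpa using hφb _ ⟨hp.1.le, hp.2⟩ _ _
  rw [← integral_sub ((hf α hα).integrable_amplitude hw k t _ _) hφint]
  calc _ ≤ ∫ p, ‖w p.1‖ * (B * Real.exp (2 * K * p.2)) + ‖w p.1‖ * E α p ∂(slab d t) := by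
        refine norm_integral_le_of_norm_le (hexp.add (hEint α hα)) (.of_forall fun p => ?_)
        have : w p.1 * k.amplitude α (f α) (r + α⁻¹ • r₁) (s + α⁻¹ • s₁) p -
            w p.1 * (φ p.2 (r + k.a • p.1) (s + k.b • p.1) * phase (k.drift r₁ s₁ p.1 * p.2)) =
            w p.1 * (D α p * phase (k.drift r₁ s₁ p.1 * p.2)) := by
          simp only [Channel.amplitude, hk.mul_rate hα, hD, add_right_comm _ (α⁻¹ • _)]
          ring
        rw [this, norm_mul, norm_mul, norm_phase, mul_one, ← mul_add]
        gcongr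
        have := le_max_left (‖D α p‖ - B * Real.exp (2 * K * p.2)) 0
        simp only [hE]
        linarith
    _ = (∫ p, ‖w p.1‖ * (B * Real.exp (2 * K * p.2)) ∂(slab d t)) +
          ∫ p, ‖w p.1‖ * E α p ∂(slab d t) := integral_add hexp (hEint α hα)
    _ ≤ _ := add_le_add (integral_slab_norm_mul_exp_le w ht hKpos hB) hEα

/-- An asymptotic bound on the distance to the limit improves itself by a factor of two. -/
lemma eventually_norm_sub_le_step (hd : 0 < d) (hw : Integrable w)
    (hf : ∀ α, 0 < α → IsMode ch w α (f α))
    (hφm : Measurable fun p : ℝ × Sp d × Sp d => φ p.1 p.2.1 p.2.2) {Z B Mφ : ℝ}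
    (hB : 0 ≤ B) (hφb : ∀ τ ∈ Icc 0 Z, ∀ r s, ‖φ τ r s‖ ≤ Mφ)
    (hφ : IsResonantSolution ch w r₁ s₁ φ)
    (h : ∀ τ ∈ Icc 0 Z, ∀ r s, ∀ δ > 0, ∀ᶠ α in atTop,
      ‖f α τ (r + α⁻¹ • r₁) (s + α⁻¹ • s₁) - φ τ r s‖ ≤
        B * Real.exp (2 * growth ι w * τ) + δ) :
    ∀ τ ∈ Icc 0 Z, ∀ r s, ∀ δ > 0, ∀ᶠ α in atTop,
      ‖f α τ (r + α⁻¹ • r₁) (s + α⁻¹ • s₁) - φ τ r s‖ ≤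
        B / 2 * Real.exp (2 * growth ι w * τ) + δ := by
  classical
  intro t ht r s δ hδ
  have hK := growth_pos (ι := ι) w
  have hcard : (0 : ℝ) < Fintype.card ι + 1 := by positivity
  have hw0 : 0 ≤ ∫ u, ‖w u‖ := integral_nonneg fun _ => norm_nonneg _
  set b := (∫ u, ‖w u‖) * (B * (Real.exp (2 * growth ι w * t) / (2 * growth ι w))) with hb
  have hb0 : 0 ≤ b := by positivity
  set δ' := δ / (Fintype.card ι + 1) with hδ'
  have hδ'0 : 0 < δ' := by positivity
  have hmono : ∀ τ ∈ Icc 0 t, τ ∈ Icc 0 Z := fun τ hτ => ⟨hτ.1, hτ.2.trans ht.2⟩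
  have hterm : ∀ j, ∀ᶠ α in atTop, ‖(∫ p, w p.1 *
        (ch j).amplitude α (f α) (r + α⁻¹ • r₁) (s + α⁻¹ • s₁) p ∂(slab d t)) -
      (if (ch j).Resonant r s then ∫ p, w p.1 *
        (φ p.2 (r + (ch j).a • p.1) (s + (ch j).b • p.1) *
          phase ((ch j).drift r₁ s₁ p.1 * p.2)) ∂(slab d t) else 0)‖ ≤ b + δ' := by
    intro j
    by_cases hk : (ch j).Resonant r s
    · simp only [hk, if_true]
      exact eventually_norm_integral_sub_le_of_resonant hw hf hφm ht.1 hB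
        (fun τ hτ => hφb τ (hmono τ hτ)) (fun τ hτ => h τ (hmono τ hτ)) (ch j) hk hδ'0
    · simp only [hk, if_false, sub_zero]
      have := (tendsto_integral_amplitude_of_not_resonant hd hw hf (ch j) hk r₁ s₁ ht.1).norm
      rw [norm_zero] at this
      filter_upwards [this.eventually_le_const hδ'0] with α hα
      linarith
  filter_upwards [eventually_all.mpr hterm, eventually_gt_atTop 0] with α hα hpos
  rw [(hf α hpos).duhamel hw ht.1, hφ t ht.1, add_sub_add_left_eq_sub, ← Finset.sum_sub_distrib]
  calc _ ≤ ∑ _j : ι, (b + δ') := by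
        refine norm_sum_le_of_le _ fun j _ => ?_
        rw [← mul_sub, norm_mul, Complex.norm_real, Real.norm_eq_abs]
        calc _ ≤ 1 * (b + δ') := by
              gcongr
              exacts [(ch j).abs_e_le, hα j]
          _ = _ := one_mul _
    _ = Fintype.card ι * b + Fintype.card ι * δ' := by
        rw [Finset.sum_const, Finset.card_univ, nsmul_eq_mul, mul_add]
    _ ≤ _ := by
        gcongr ?_ + ?_
        · have : Fintype.card ι * (∫ u, ‖w u‖) ≤ growth ι w := by unfold growth; linarith
          calc _ = (Fintype.card ι * (∫ u, ‖w u‖)) *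
                  (B * (Real.exp (2 * growth ι w * t) / (2 * growth ι w))) := by rw [hb]; ring
            _ ≤ growth ι w * (B * (Real.exp (2 * growth ι w * t) / (2 * growth ι w))) := by
                gcongr
            _ = _ := by field_simp
        · rw [hδ', mul_div_assoc', div_le_iff₀ hcard]
          nlinarith

/-- As `α → ∞`, a mode seen at `(r + r₁/α, s + s₁/α)` converges to the bounded solution of the
resonant equation: the asymptotic distance is bounded, and `eventually_norm_sub_le_step` halves
the bound indefinitely. -/
theorem tendsto_of_isResonantSolution (hd : 0 < d) (hw : Integrable w)
    (hf : ∀ α, 0 < α → IsMode ch w α (f α))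
    (hφm : Measurable fun p : ℝ × Sp d × Sp d => φ p.1 p.2.1 p.2.2)
    (hφb : ∀ Z, ∃ M, ∀ τ ∈ Icc 0 Z, ∀ r s, ‖φ τ r s‖ ≤ M)
    (hφ : IsResonantSolution ch w r₁ s₁ φ) {t : ℝ} (ht : 0 ≤ t) (r s : Sp d) :
    Tendsto (fun α => f α t (r + α⁻¹ • r₁) (s + α⁻¹ • s₁)) atTop (𝓝 (φ t r s)) := by
  obtain ⟨Mφ, hMφ⟩ := hφb t
  have hK := growth_pos (ι := ι) w
  set B := 2 * Real.exp (2 * growth ι w * t) + Mφ with hB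
  have hMφ0 : 0 ≤ Mφ := (norm_nonneg _).trans (hMφ t ⟨ht, le_rfl⟩ 0 0)
  have hB0 : 0 ≤ B := by positivity
  have key : ∀ n : ℕ, ∀ τ ∈ Icc 0 t, ∀ r s, ∀ δ > 0, ∀ᶠ α in atTop,
      ‖f α τ (r + α⁻¹ • r₁) (s + α⁻¹ • s₁) - φ τ r s‖ ≤
        B / 2 ^ n * Real.exp (2 * growth ι w * τ) + δ := by
    intro n
    induction n with
    | zero =>
      intro τ hτ r s δ hδ
      filter_upwards [eventually_gt_atTop 0] with α hα
      have h1 : 1 ≤ Real.exp (2 * growth ι w * τ) :=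
        Real.one_le_exp (by have := hτ.1; positivity)
      have h2 := (norm_sub_le _ _).trans (add_le_add
        ((hf α hα).norm_le_of_le hw hτ (r + α⁻¹ • r₁) (s + α⁻¹ • s₁)) (hMφ τ hτ r s))
      simp only [pow_zero, div_one]
      nlinarith
    | succ n ih =>
      have := eventually_norm_sub_le_step hd hw hf hφm (by positivity) hMφ hφ ih
      simpa only [pow_succ, div_mul_eq_div_div] using this
  have hlim : Tendsto (fun n : ℕ => B / 2 ^ n * Real.exp (2 * growth ι w * t)) atTop
      (𝓝 (0 * Real.exp (2 * growth ι w * t))) :=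
    (tendsto_const_nhds.div_atTop (tendsto_pow_atTop_atTop_of_one_lt (by norm_num))).mul_const _
  rw [zero_mul] at hlim
  rw [Metric.tendsto_nhds]
  intro ε hε
  obtain ⟨n, hn⟩ := (hlim.eventually_lt_const (half_pos hε)).exists
  filter_upwards [key n t ⟨ht, le_rfl⟩ r s (ε / 2) (half_pos hε)] with α hα
  rw [dist_eq_norm]
  linarith

end Limit

/-! ### The six channels of the reflected Wigner system -/

/-- The six exchange terms, in the order in which they appear in the system. -/
def channels : Fin 6 → Channel :=
  ![⟨-1, 0, 0, 1, by norm_num⟩, ⟨1, 0, 0, 1, by norm_num⟩, ⟨0, -1, 0, 1, by norm_num⟩,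
    ⟨0, 1, 0, 1, by norm_num⟩, ⟨-1, 1, -1, -1, by norm_num⟩, ⟨-1, -1, -1, -1, by norm_num⟩]

/-- The rate `∫ w(u) (e^{-i r·u τ} + e^{i r·u τ}) du` at which a layer profile grows. -/
noncomputable def layerRate (w : Sp d → ℂ) (r : Sp d) (τ : ℝ) : ℂ :=
  (∫ u, w u * phase (-1 * ⟪r, u⟫ * τ)) + ∫ u, w u * phase (1 * ⟪r, u⟫ * τ)

/-- The layer profile of an exchange system, with the loss term factored out. -/
noncomputable def layerMode (w : Sp d → ℂ) (r : Sp d) (t : ℝ) : ℂ :=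
  Complex.exp (∫ τ in (0 : ℝ)..t, layerRate w r τ)

open scoped Classical in
/-- The large-`α` limit of the six-channel mode seen at `(r + r₁/α, s + s₁/α)`: a profile for each
of the layers `s = 0` and `r = 0` that contains the point. -/
noncomputable def limitMode (w : Sp d → ℂ) (r₁ s₁ : Sp d) (t : ℝ) (r s : Sp d) : ℂ :=
  1 + (if s = 0 then layerMode w s₁ t - 1 else 0) + (if r = 0 then layerMode w r₁ t - 1 else 0)

section

variable {w : Sp d → ℂ}

lemma continuous_integral_mul_phase (hw : Integrable w) (σ : ℝ) (r : Sp d) :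
    Continuous fun τ : ℝ => ∫ u, w u * phase (σ * ⟪r, u⟫ * τ) := by
  refine continuous_of_dominated (bound := fun u => ‖w u‖) (fun τ => ?_) (fun τ => ?_) hw.norm ?_
  · exact hw.aestronglyMeasurable.mul (Continuous.aestronglyMeasurable (by fun_prop))
  · exact .of_forall fun u => by simp
  · exact .of_forall fun u => by fun_prop

lemma continuous_layerRate (hw : Integrable w) (r : Sp d) : Continuous (layerRate w r) :=
  (continuous_integral_mul_phase hw (-1) r).add (continuous_integral_mul_phase hw 1 r)

lemma hasDerivAt_layerMode (hw : Integrable w) (r : Sp d) (t : ℝ) :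
    HasDerivAt (layerMode w r) (layerMode w r t * layerRate w r t) t :=
  ((continuous_layerRate hw r).integral_hasStrictDerivAt 0 t).hasDerivAt.cexp

lemma continuous_layerMode (hw : Integrable w) (r : Sp d) : Continuous (layerMode w r) :=
  continuous_iff_continuousAt.mpr fun t => (hasDerivAt_layerMode hw r t).continuousAt

/-- The two channels that are resonant in a layer reproduce the layer profile. -/
lemma integral_slab_layerMode (hw : Integrable w) (r : Sp d) {t : ℝ} (ht : 0 ≤ t) :
    (∫ p, w p.1 * (layerMode w r p.2 * phase (-1 * ⟪r, p.1⟫ * p.2)) ∂(slab d t)) +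
      ∫ p, w p.1 * (layerMode w r p.2 * phase (1 * ⟪r, p.1⟫ * p.2)) ∂(slab d t) =
    layerMode w r t - 1 := by
  have hc := continuous_layerMode hw r
  obtain ⟨M, hM⟩ := (isCompact_Icc (a := (0 : ℝ)) (b := t)).exists_bound_of_continuousOn
    hc.continuousOn
  have one : ∀ σ : ℝ,
      ∫ p, w p.1 * (layerMode w r p.2 * phase (σ * ⟪r, p.1⟫ * p.2)) ∂(slab d t) =
      ∫ τ in (0 : ℝ)..t, layerMode w r τ * ∫ u, w u * phase (σ * ⟪r, u⟫ * τ) := by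
    intro σ
    have hint : Integrable
        (fun p : Sp d × ℝ => w p.1 * (layerMode w r p.2 * phase (σ * ⟪r, p.1⟫ * p.2)))
        (slab d t) := by
      refine integrable_slab_mul hw t (M := M) (Continuous.aestronglyMeasurable (by fun_prop)) ?_
      filter_upwards [ae_slab_mem t] with p hp
      simpa using hM p.2 ⟨hp.1.le, hp.2⟩
    rw [intervalIntegral.integral_of_le ht]
    refine (integral_prod_symm _ hint).trans ?_
    refine integral_congr_ae (.of_forall fun τ => ?_)
    simp only
    rw [← integral_const_mul]
    refine integral_congr_ae (.of_forall fun u => ?_)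
    simp only
    ring
  have hci : ∀ σ : ℝ, IntervalIntegrable
      (fun τ => layerMode w r τ * ∫ u, w u * phase (σ * ⟪r, u⟫ * τ)) volume 0 t :=
    fun σ => (hc.mul (continuous_integral_mul_phase hw σ r)).intervalIntegrable _ _
  rw [one, one, ← intervalIntegral.integral_add (hci _) (hci _)]
  have := intervalIntegral.integral_eq_sub_of_hasDerivAt (a := 0) (b := t)
    (fun τ _ => hasDerivAt_layerMode hw r τ)
    ((hc.mul (continuous_layerRate hw r)).intervalIntegrable _ _)
  simp only [← mul_add]
  refine this.trans ?_
  simp [layerMode]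

lemma measurable_limitMode (hw : Integrable w) (r₁ s₁ : Sp d) :
    Measurable fun p : ℝ × Sp d × Sp d => limitMode w r₁ s₁ p.1 p.2.1 p.2.2 := by
  have h : ∀ r, Measurable (layerMode w r) := fun r => (continuous_layerMode hw r).measurable
  unfold limitMode
  refine (measurable_const.add (Measurable.ite ?_ ?_ measurable_const)).add
    (Measurable.ite ?_ ?_ measurable_const)
  · exact (measurableSet_singleton (0 : Sp d)).preimage
      (f := fun p : ℝ × Sp d × Sp d => p.2.2) (by fun_prop)
  · exact ((h s₁).comp measurable_fst).sub measurable_const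
  · exact (measurableSet_singleton (0 : Sp d)).preimage
      (f := fun p : ℝ × Sp d × Sp d => p.2.1) (by fun_prop)
  · exact ((h r₁).comp measurable_fst).sub measurable_const

lemma exists_norm_limitMode_le (hw : Integrable w) (r₁ s₁ : Sp d) (Z : ℝ) :
    ∃ M, ∀ τ ∈ Icc 0 Z, ∀ r s, ‖limitMode w r₁ s₁ τ r s‖ ≤ M := by
  have hb : ∀ r, ∃ M, ∀ τ ∈ Icc 0 Z, ‖layerMode w r τ - 1‖ ≤ M := fun r =>
    (isCompact_Icc (a := (0 : ℝ)) (b := Z)).exists_bound_of_continuousOn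
      ((continuous_layerMode hw r).sub continuous_const).continuousOn
  obtain ⟨M₁, h₁⟩ := hb s₁
  obtain ⟨M₂, h₂⟩ := hb r₁
  refine ⟨1 + M₁ + M₂, fun τ hτ r s => ?_⟩
  have h₁' := h₁ τ hτ
  have h₂' := h₂ τ hτ
  unfold limitMode
  refine (norm_add₃_le).trans ?_
  gcongr
  · simp
  · split_ifs
    exacts [h₁', by simpa using (norm_nonneg _).trans h₁']
  · split_ifs
    exacts [h₂', by simpa using (norm_nonneg _).trans h₂']

lemma isResonantSolution_limitMode (hd : 0 < d) (hw : Integrable w) (r₁ s₁ : Sp d) :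
    IsResonantSolution channels w r₁ s₁ (limitMode w r₁ s₁) := by
  classical
  intro t ht r s
  -- almost every shift leaves the other layer
  have hs : ∀ a : ℝ, a ≠ 0 → s = 0 →
      ∫ p, w p.1 * (limitMode w r₁ s₁ p.2 (r + a • p.1) s * phase (a * ⟪s₁, p.1⟫ * p.2)) ∂(slab d t) =
      ∫ p, w p.1 * (layerMode w s₁ p.2 * phase (a * ⟪s₁, p.1⟫ * p.2)) ∂(slab d t) := by
    intro a ha h0
    refine integral_congr_ae ?_
    filter_upwards [ae_slab_of_ae (ae_add_smul_ne_zero hd r ha)] with p hp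
    simp [limitMode, h0, hp]
  have hr : ∀ b : ℝ, b ≠ 0 → r = 0 →
      ∫ p, w p.1 * (limitMode w r₁ s₁ p.2 r (s + b • p.1) * phase (b * ⟪r₁, p.1⟫ * p.2)) ∂(slab d t) =
      ∫ p, w p.1 * (layerMode w r₁ p.2 * phase (b * ⟪r₁, p.1⟫ * p.2)) ∂(slab d t) := by
    intro b hb h0
    refine integral_congr_ae ?_
    filter_upwards [ae_slab_of_ae (ae_add_smul_ne_zero hd s hb)] with p hp
    simp [limitMode, h0, hp]
  have es := integral_slab_layerMode hw s₁ ht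
  have er := integral_slab_layerMode hw r₁ ht
  rw [Fin.sum_univ_six]
  simp only [channels, Channel.Resonant, Channel.drift, Fin.isValue, Matrix.cons_val, zero_smul,
    add_zero, zero_add, zero_mul, neg_eq_zero, one_ne_zero, false_and, if_false, mul_zero,
    true_and, smul_eq_zero, false_or, Complex.ofReal_one, one_mul]
  have As : (if s = 0 then ∫ p, w p.1 * (limitMode w r₁ s₁ p.2 (r + (-1 : ℝ) • p.1) s *
        phase (-1 * ⟪s₁, p.1⟫ * p.2)) ∂(slab d t) else 0) +
      (if s = 0 then ∫ p, w p.1 * (limitMode w r₁ s₁ p.2 (r + (1 : ℝ) • p.1) s *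
        phase (1 * ⟪s₁, p.1⟫ * p.2)) ∂(slab d t) else 0) =
      if s = 0 then layerMode w s₁ t - 1 else 0 := by
    split_ifs with h
    · rw [hs _ (by norm_num) h, hs _ one_ne_zero h, es]
    · simp
  have Ar : (if r = 0 then ∫ p, w p.1 * (limitMode w r₁ s₁ p.2 r (s + (-1 : ℝ) • p.1) *
        phase (-1 * ⟪r₁, p.1⟫ * p.2)) ∂(slab d t) else 0) +
      (if r = 0 then ∫ p, w p.1 * (limitMode w r₁ s₁ p.2 r (s + (1 : ℝ) • p.1) *
        phase (1 * ⟪r₁, p.1⟫ * p.2)) ∂(slab d t) else 0) =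
      if r = 0 then layerMode w r₁ t - 1 else 0 := by
    split_ifs with h
    · rw [hr _ (by norm_num) h, hr _ one_ne_zero h, er]
    · simp
  simp only [one_mul] at As Ar
  rw [limitMode, ← As, ← Ar]
  ring

/-- A six-channel mode converges to `limitMode` as `α → ∞`. -/
theorem tendsto_limitMode (hd : 0 < d) (hw : Integrable w) {f : ℝ → ℝ → Sp d → Sp d → ℂ}
    (hf : ∀ α, 0 < α → IsMode channels w α (f α)) (r₁ s₁ : Sp d) {t : ℝ} (ht : 0 ≤ t)
    (r s : Sp d) :
    Tendsto (fun α => f α t (r + α⁻¹ • r₁) (s + α⁻¹ • s₁)) atTop (𝓝 (limitMode w r₁ s₁ t r s)) :=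
  tendsto_of_isResonantSolution hd hw hf (measurable_limitMode hw r₁ s₁)
    (exists_norm_limitMode_le hw r₁ s₁) (isResonantSolution_limitMode hd hw r₁ s₁) ht r s

end

/-! ### Integration against complex measures -/

lemma norm_pairing_le {μ : ComplexMeasure (Sp d)} [IsFiniteMeasure μ.variation]
    {ψ : Sp d → ℂ} (hψ : ∀ q, ‖ψ q‖ ≤ 1) : ‖pairing μ ψ‖ ≤ μ.variation.real univ := by
  have h := VectorMeasure.norm_integral_le_of_norm_le_const (μ := μ)
    (B := ContinuousLinearMap.mul ℝ ℂ) (.of_forall hψ)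
  refine h.trans ?_
  rw [one_mul]
  exact mul_le_of_le_one_left measureReal_nonneg (ContinuousLinearMap.opNorm_mul_le _ _)

@[simp]
lemma pairing_dirac (a : Sp d) (z : ℂ) (ψ : Sp d → ℂ) :
    pairing (VectorMeasure.dirac a z) ψ = ψ a * z := by
  simp [pairing]

lemma pairing_indicator_const (μ : ComplexMeasure (Sp d)) [IsFiniteMeasure μ.variation]
    {A : Set (Sp d)} (hA : MeasurableSet A) (z : ℂ) :
    pairing μ (A.indicator fun _ => z) = z * μ A := by
  rw [pairing, VectorMeasure.integral_indicator hA, VectorMeasure.integral_const]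
  simp [VectorMeasure.restrict_apply _ hA]

lemma pairing_add {μ : ComplexMeasure (Sp d)} {ψ χ : Sp d → ℂ} (hψ : μ.Integrable ψ)
    (hχ : μ.Integrable χ) : pairing μ (ψ + χ) = pairing μ ψ + pairing μ χ :=
  VectorMeasure.integral_add hψ hχ

lemma integrable_simpleFunc (μ : ComplexMeasure (Sp d)) [IsFiniteMeasure μ.variation]
    (g : SimpleFunc (Sp d) ℂ) : μ.Integrable g :=
  SimpleFunc.integrable_of_isFiniteMeasure g

/-- A bounded measurable function is a boundedly convergent limit of simple functions, along which
the pairing converges. -/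
lemma exists_tendsto_pairing {ψ : Sp d → ℂ} (hψ : Measurable ψ) {M : ℝ} (hM : ∀ q, ‖ψ q‖ ≤ M) :
    ∃ g : ℕ → SimpleFunc (Sp d) ℂ, (∀ n q, ‖g n q‖ ≤ M) ∧
      (∀ q, Tendsto (fun n => g n q) atTop (𝓝 (ψ q))) ∧
      ∀ μ : ComplexMeasure (Sp d), IsFiniteMeasure μ.variation →
        Tendsto (fun n => pairing μ (g n)) atTop (𝓝 (pairing μ ψ)) := by
  have hs : StronglyMeasurable ψ := hψ.stronglyMeasurable
  have hM0 : 0 ≤ M := (norm_nonneg _).trans (hM 0)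
  have hlim : ∀ q, Tendsto (fun n => hs.approxBounded M n q) atTop (𝓝 (ψ q)) := fun q =>
    StronglyMeasurable.tendsto_approxBounded_of_norm_le hs (hM q)
  refine ⟨hs.approxBounded M, fun n q => hs.norm_approxBounded_le hM0 n q, hlim, fun μ hμ => ?_⟩
  refine VectorMeasure.tendsto_integral_filter_of_norm_le_const ?_ ⟨M, ?_⟩ (.of_forall hlim)
  · exact .of_forall fun n => (SimpleFunc.measurable _).aestronglyMeasurable
  · exact .of_forall fun n => .of_forall fun q => hs.norm_approxBounded_le hM0 n q

/-- The pairing with a bounded measurable function depends measurably on the measure. -/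
lemma measurable_pairing {X : Type*} [MeasurableSpace X] {W : X → ComplexMeasure (Sp d)}
    (hfin : ∀ x, IsFiniteMeasure (W x).variation)
    (hW : ∀ A, MeasurableSet A → Measurable fun x => W x A) {ψ : Sp d → ℂ} (hψ : Measurable ψ)
    {M : ℝ} (hM : ∀ q, ‖ψ q‖ ≤ M) : Measurable fun x => pairing (W x) ψ := by
  obtain ⟨g, -, -, hg⟩ := exists_tendsto_pairing hψ hM
  refine measurable_of_tendsto_metrizable (f := fun n x => pairing (W x) (g n)) (fun n => ?_)
    (tendsto_pi_nhds.mpr fun x => hg (W x) (hfin x))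
  classical
  induction g n using SimpleFunc.induction with
  | @const z A hA =>
    simp only [SimpleFunc.coe_piecewise, SimpleFunc.coe_const, Function.const_zero]
    have : ∀ x, pairing (W x) (A.piecewise (Function.const _ z) 0) = z * W x A := fun x => by
      have := hfin x
      rw [Set.piecewise_eq_indicator]
      exact pairing_indicator_const (W x) hA z
    simp only [this]
    exact (hW _ hA).const_mul z
  | @add g₁ g₂ _ hf hg =>
    have : ∀ x, pairing (W x) (⇑g₁ + ⇑g₂) = pairing (W x) g₁ + pairing (W x) g₂ := fun x =>
      have := hfin x
      pairing_add (integrable_simpleFunc (W x) _) (integrable_simpleFunc (W x) _)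
    simp only [SimpleFunc.coe_add, this]
    exact hf.add hg

/-- A complex measure of finite variation has a density with respect to its variation. -/
lemma exists_density (μ : ComplexMeasure (Sp d)) [IsFiniteMeasure μ.variation] :
    ∃ h : Sp d → ℂ, Integrable h μ.variation ∧
      ∀ A, MeasurableSet A → μ A = ∫ q in A, h q ∂μ.variation := by
  have hac : μ ≪ᵥ μ.variation.toENNRealVectorMeasure := by
    refine VectorMeasure.AbsolutelyContinuous.mk fun A hA h0 => ?_
    rw [Measure.toENNRealVectorMeasure_apply_measurable hA] at h0
    have := VectorMeasure.enorm_measure_le_variation μ A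
    rw [h0] at this
    simpa using this
  obtain ⟨hre, him⟩ := (ComplexMeasure.absolutelyContinuous_ennreal_iff _ _).mp hac
  set s := ComplexMeasure.re μ with hs
  set t := ComplexMeasure.im μ with ht
  have es := (SignedMeasure.absolutelyContinuous_iff_withDensityᵥ_rnDeriv_eq s μ.variation).mp hre
  have et := (SignedMeasure.absolutelyContinuous_iff_withDensityᵥ_rnDeriv_eq t μ.variation).mp him
  have is := SignedMeasure.integrable_rnDeriv s μ.variation
  have it := SignedMeasure.integrable_rnDeriv t μ.variation
  refine ⟨fun q => (s.rnDeriv μ.variation q : ℂ) + (t.rnDeriv μ.variation q : ℂ) * Complex.I,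
    is.ofReal.add (it.ofReal.mul_const _), fun A hA => ?_⟩
  have h1 : s A = ∫ q in A, s.rnDeriv μ.variation q ∂μ.variation := by
    conv_lhs => rw [← es]
    exact withDensityᵥ_apply is hA
  have h2 : t A = ∫ q in A, t.rnDeriv μ.variation q ∂μ.variation := by
    conv_lhs => rw [← et]
    exact withDensityᵥ_apply it hA
  have h3 : ∫ q in A, ((s.rnDeriv μ.variation q : ℂ) +
      (t.rnDeriv μ.variation q : ℂ) * Complex.I) ∂μ.variation = (s A : ℂ) + (t A : ℂ) * Complex.I := by
    have is' : Integrable (fun q => (s.rnDeriv μ.variation q : ℂ)) μ.variation := is.ofReal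
    have it' : Integrable (fun q => (t.rnDeriv μ.variation q : ℂ)) μ.variation := it.ofReal
    rw [integral_add is'.restrict (it'.mul_const _).restrict, integral_mul_const,
      integral_complex_ofReal, integral_complex_ofReal, ← h1, ← h2]
  refine Eq.trans ?_ h3.symm
  exact (Complex.re_add_im (μ A)).symm

/-- With the density of `exists_density`, the pairing becomes a Bochner integral, to which the usual
Fubini theorem applies. -/
lemma exists_pairing_eq_integral (μ : ComplexMeasure (Sp d)) [IsFiniteMeasure μ.variation] :
    ∃ h : Sp d → ℂ, Integrable h μ.variation ∧ ∀ (ψ : Sp d → ℂ) (M : ℝ), Measurable ψ →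
      (∀ q, ‖ψ q‖ ≤ M) → pairing μ ψ = ∫ q, ψ q * h q ∂μ.variation := by
  obtain ⟨h, hi, hA⟩ := exists_density μ
  refine ⟨h, hi, fun ψ M hψ hM => ?_⟩
  have hsimple : ∀ g : SimpleFunc (Sp d) ℂ, pairing μ g = ∫ q, g q * h q ∂μ.variation := by
    intro g
    have hint : ∀ g : SimpleFunc (Sp d) ℂ, Integrable (fun q => g q * h q) μ.variation := by
      intro g
      obtain ⟨C, hC⟩ := g.exists_forall_norm_le
      exact hi.bdd_mul (SimpleFunc.measurable g).aestronglyMeasurable (.of_forall hC)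
    classical
    induction g using SimpleFunc.induction with
    | const z hm =>
      simp only [SimpleFunc.coe_piecewise, SimpleFunc.coe_const, Function.const_zero]
      rw [Set.piecewise_eq_indicator]
      refine (pairing_indicator_const μ hm z).trans ?_
      rw [hA _ hm, ← integral_const_mul, ← integral_indicator hm]
      refine integral_congr_ae (.of_forall fun q => ?_)
      simp only [indicator, Function.const_apply]
      split_ifs <;> simp
    | add _ h1 h2 =>
      rw [SimpleFunc.coe_add,
        pairing_add (integrable_simpleFunc μ _) (integrable_simpleFunc μ _), h1, h2,
        ← integral_add (hint _) (hint _)]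
      simp only [Pi.add_apply, add_mul]
  obtain ⟨g, hgM, hgl, hg⟩ := exists_tendsto_pairing hψ hM
  refine tendsto_nhds_unique (hg μ inferInstance) ?_
  simp only [hsimple]
  refine tendsto_integral_of_dominated_convergence (fun q => M * ‖h q‖) (fun n => ?_)
    (hi.norm.const_mul M) (fun n => .of_forall fun q => ?_) (.of_forall fun q => ?_)
  · exact (SimpleFunc.measurable _).aestronglyMeasurable.mul hi.aestronglyMeasurable
  · rw [norm_mul]; gcongr; exact hgM n q
  · exact (hgl q).mul_const _

lemma pairing_const_mul (μ : ComplexMeasure (Sp d)) [IsFiniteMeasure μ.variation] {ψ : Sp d → ℂ}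
    (hψ : Measurable ψ) {M : ℝ} (hM : ∀ q, ‖ψ q‖ ≤ M) (z : ℂ) :
    pairing μ (fun q => z * ψ q) = z * pairing μ ψ := by
  obtain ⟨h, -, hp⟩ := exists_pairing_eq_integral μ
  rw [hp ψ M hψ hM, hp (fun q => z * ψ q) (‖z‖ * M) (hψ.const_mul z)
    (fun q => by rw [norm_mul]; gcongr; exact hM q), ← integral_const_mul]
  simp only [mul_assoc]

/-- The character `q ↦ e^{i k·q}`. -/
noncomputable def character (k q : Sp d) : ℂ := phase ⟪k, q⟫

@[simp]
lemma norm_character (k q : Sp d) : ‖character k q‖ = 1 := norm_phase _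

@[fun_prop]
lemma continuous_character (k : Sp d) : Continuous (character k) := by
  unfold character; fun_prop

lemma continuous_pairing_character (μ : ComplexMeasure (Sp d)) [IsFiniteMeasure μ.variation] :
    Continuous fun k => pairing μ (character k) := by
  refine VectorMeasure.continuous_of_dominated (bound := fun _ => 1)
    (fun k => (continuous_character k).aestronglyMeasurable) (fun k => .of_forall fun q => by simp)
    (integrable_const _) (.of_forall fun q => ?_)
  unfold character; fun_prop

/-- The pairing commutes with a superposition of characters. -/
lemma pairing_integral_character (μ : ComplexMeasure (Sp d)) [IsFiniteMeasure μ.variation]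
    {g : Sp d → ℂ} (hg : Integrable g) :
    pairing μ (fun q => ∫ k, g k * character k q) = ∫ k, g k * pairing μ (character k) := by
  obtain ⟨h, hi, hp⟩ := exists_pairing_eq_integral μ
  have hint : Integrable (fun x : Sp d × Sp d => g x.2 * character x.2 x.1 * h x.1)
      (μ.variation.prod volume) := by
    have h1 : Integrable (fun x : Sp d × Sp d => h x.1 * g x.2) (μ.variation.prod volume) :=
      hi.mul_prod hg
    have h2 : AEStronglyMeasurable (fun x : Sp d × Sp d => character x.2 x.1)
        (μ.variation.prod volume) :=
      Continuous.aestronglyMeasurable (by unfold character; fun_prop)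
    have := h1.bdd_mul (c := 1) h2 (.of_forall fun x => by simp)
    refine this.congr (.of_forall fun x => ?_)
    simp only
    ring
  have hcont : Continuous fun q => ∫ k, g k * character k q := by
    refine continuous_of_dominated (bound := fun k => ‖g k‖) (fun q => ?_)
      (fun q => .of_forall fun k => by simp) hg.norm (.of_forall fun k => by fun_prop)
    exact hg.aestronglyMeasurable.mul
      (Continuous.aestronglyMeasurable (by unfold character; fun_prop))
  rw [hp _ (∫ k, ‖g k‖) hcont.measurable
    fun q => norm_integral_le_of_norm_le hg.norm (.of_forall fun k => by simp)]
  calc _ = ∫ q, (∫ k, g k * character k q * h q) ∂μ.variation := by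
        simp only [integral_mul_const]
    _ = ∫ k, ∫ q, g k * character k q * h q ∂μ.variation := integral_integral_swap hint
    _ = _ := by
        refine integral_congr_ae (.of_forall fun k => ?_)
        simp only [mul_assoc]
        rw [integral_const_mul, hp _ 1 (continuous_character k).measurable fun q => by simp]

/-- Finiteness of the variation from a bound by a finite constant. -/
lemma isFiniteMeasure_variation {μ : ComplexMeasure (Sp d)} {M : ℝ≥0}
    (h : μ.variation univ ≤ M) : IsFiniteMeasure μ.variation :=
  ⟨h.trans_lt ENNReal.coe_lt_top⟩

/-! ### Fourier modes of a solution -/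

lemma halfShift_character (u k : Sp d) :
    halfShift u (character k) = fun q => phase ((1 / 2 : ℝ) * ⟪k, u⟫) * character k q := by
  funext q
  simp only [halfShift, character]
  rw [inner_add_right, real_inner_smul_right, phase_add, mul_comm]

/-- The weight of the exchange system solved by the Fourier mode of frequency `k`; the phase comes
from the half shift in `q`. -/
noncomputable def modeWeight (β : ℝ) (Chat₀ : Sp d → ℝ) (k u : Sp d) : ℂ :=
  ((β / (2 * Real.pi) ^ d : ℝ) : ℂ) * ((Chat₀ u : ℂ) * phase ((1 / 2 : ℝ) * ⟪k, u⟫))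

lemma integrable_modeWeight {β : ℝ} {Chat₀ : Sp d → ℝ} (h : Integrable Chat₀) (k : Sp d) :
    Integrable (modeWeight β Chat₀ k) := by
  unfold modeWeight
  refine Integrable.const_mul ?_ _
  refine (h.ofReal (𝕜 := ℂ)).mul_bdd (c := 1)
    (Continuous.aestronglyMeasurable (by fun_prop)) (.of_forall fun u => by simp)

lemma norm_modeWeight (β : ℝ) (Chat₀ : Sp d → ℝ) (k u : Sp d) :
    ‖modeWeight β Chat₀ k u‖ = ‖modeWeight β Chat₀ 0 u‖ := by
  simp [modeWeight]

/-- The Fourier mode of frequency `k` of a measure-valued family, with a loss factor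
`e^{-ct}` divided out.  Negative times are frozen at `0`. -/
noncomputable def fourierMode (c : ℝ) (V : ℝ → Sp d → Sp d → ComplexMeasure (Sp d)) (k : Sp d)
    (t : ℝ) (r s : Sp d) : ℂ :=
  (Real.exp (c * max t 0) : ℂ) * pairing (V (max t 0) r s) (character k)

lemma fourierMode_of_nonneg (c : ℝ) (V : ℝ → Sp d → Sp d → ComplexMeasure (Sp d)) (k : Sp d)
    {t : ℝ} (ht : 0 ≤ t) (r s : Sp d) :
    fourierMode c V k t r s = (Real.exp (c * t) : ℂ) * pairing (V t r s) (character k) := by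
  rw [fourierMode, max_eq_left ht]

namespace IsSolution

variable {α β : ℝ} {Chat₀ C₀ : Sp d → ℝ} {V : ℝ → Sp d → Sp d → ComplexMeasure (Sp d)}

lemma isFiniteMeasure (hV : IsSolution α β Chat₀ V) {t : ℝ} (ht : 0 ≤ t) (r s : Sp d) :
    IsFiniteMeasure (V t r s).variation := by
  obtain ⟨M, hM⟩ := hV.bounded t
  exact isFiniteMeasure_variation (hM t ht le_rfl r s)

lemma measurable_pairing_character (hV : IsSolution α β Chat₀ V) {t : ℝ} (ht : 0 ≤ t) (k : Sp d) :
    Measurable fun p : Sp d × Sp d => pairing (V t p.1 p.2) (character k) :=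
  measurable_pairing (W := fun p : Sp d × Sp d => V t p.1 p.2) (ψ := character k)
    (fun p => hV.isFiniteMeasure ht p.1 p.2) (fun A hA => hV.measurable t ht A hA)
    (continuous_character k).measurable (M := 1) fun q => by simp

lemma exists_norm_pairing_character_le (hV : IsSolution α β Chat₀ V) (Z : ℝ) :
    ∃ M : ℝ, ∀ t ∈ Icc 0 Z, ∀ r s k, ‖pairing (V t r s) (character k)‖ ≤ M := by
  obtain ⟨M, hM⟩ := hV.bounded Z
  refine ⟨M, fun t ht r s k => ?_⟩
  have := hV.isFiniteMeasure ht.1 r s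
  refine (norm_pairing_le fun q => by simp).trans ?_
  exact ENNReal.toReal_le_of_le_ofReal M.2 (by simpa using hM t ht.1 ht.2 r s)

lemma hasDerivWithinAt_pairing_character (hV : IsSolution α β Chat₀ V) {t : ℝ} (ht : 0 ≤ t)
    (r s k : Sp d) : HasDerivWithinAt (fun τ => pairing (V τ r s) (character k))
      (systemRHS α β Chat₀ t (V t) r s (character k)) (Ici 0) t :=
  hV.equation (BoundedContinuousFunction.ofNormedAddCommGroup (character k)
    (continuous_character k) 1 fun q => by simp) r s t ht

/-- Tested against a character, the right-hand side of the system is the six-channel exchange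
operator minus the loss term. -/
lemma systemRHS_character (hV : IsSolution α β Chat₀ V) (hC : IsSpectralDensity C₀ Chat₀) {t : ℝ}
    (ht : 0 ≤ t) (k r s : Sp d) :
    systemRHS α β Chat₀ t (V t) r s (character k) =
      (∑ j, ∫ u, (channels j).integrand (modeWeight β Chat₀ k) α t
        (fun r s => pairing (V t r s) (character k)) r s u) -
      ((2 * β * C₀ 0 : ℝ) : ℂ) * pairing (V t r s) (character k) := by
  set g : Sp d → Sp d → ℂ := fun r s => pairing (V t r s) (character k) with hg
  set w := modeWeight β Chat₀ k with hw
  have hwi : Integrable w := integrable_modeWeight hC.integrable k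
  have hgm : Measurable fun p : Sp d × Sp d => g p.1 p.2 := hV.measurable_pairing_character ht k
  obtain ⟨M, hM⟩ := hV.exists_norm_pairing_character_le t
  have hgM : ∀ r s, ‖g r s‖ ≤ M := fun r s => hM t ⟨ht, le_rfl⟩ r s k
  have hshift : ∀ r s u, pairing (V t r s) (halfShift u (character k)) =
      phase ((1 / 2 : ℝ) * ⟪k, u⟫) * g r s := by
    intro r s u
    have := hV.isFiniteMeasure ht r s
    rw [halfShift_character]
    exact pairing_const_mul _ (continuous_character k).measurable (M := 1) (fun q => by simp) _
  have hint : ∀ j, Integrable fun u => (channels j).integrand w α t g r s u := by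
    intro j
    refine Integrable.const_mul (hwi.mul_bdd (c := M) ?_ (.of_forall fun u => ?_)) _
    · refine (Measurable.mul ?_ ?_).aestronglyMeasurable
      · exact hgm.comp (f := fun u : Sp d =>
          (r + (channels j).a • u, s + (channels j).b • u)) (by fun_prop)
      · refine continuous_phase.measurable.comp ?_
        fun_prop
    · simpa using hgM _ _
  have hCi : Integrable fun u => (Chat₀ u : ℂ) := hC.integrable.ofReal
  have h0 : (C₀ 0 : ℂ) = (((2 * Real.pi) ^ d)⁻¹ : ℝ) * ∫ u : Sp d, (Chat₀ u : ℂ) := by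
    have := hC.inversion 0
    simpa using this
  rw [← integral_finsetSum _ fun j _ => hint j]
  have e : ((2 * β * C₀ 0 : ℝ) : ℂ) * g r s =
      ∫ u : Sp d, ((β / (2 * Real.pi) ^ d : ℝ) : ℂ) * ((Chat₀ u : ℂ) * (2 * g r s)) := by
    rw [integral_const_mul, integral_mul_const]
    push_cast at h0 ⊢
    rw [h0]
    ring
  rw [e, ← integral_sub (integrable_finsetSum _ fun j _ => hint j)
    ((hCi.mul_const _).const_mul _), systemRHS, ← integral_const_mul]
  refine integral_congr_ae (.of_forall fun u => ?_)
  simp only [hshift]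
  rw [Fin.sum_univ_six]
  simp only [channels, Channel.integrand, Channel.rate, Fin.isValue, Matrix.cons_val, zero_smul,
    add_zero, zero_add, zero_mul, neg_smul, one_smul, ← sub_eq_add_neg, neg_mul, one_mul,
    mul_neg, hw, modeWeight, inner_sub_left, inner_add_left, hg]
  have e1 : α * (-⟪r, u⟫ - ⟪s, u⟫ - ‖u‖ ^ 2) * t = -(α * (⟪r, u⟫ + ⟪s, u⟫ + ‖u‖ ^ 2) * t) := by
    ring
  rw [e1]
  push_cast
  simp only [← mul_neg]
  ring_nf

/-- The Fourier modes of a solution solve the six-channel exchange system. -/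
lemma isMode_fourierMode (hV : IsSolution α β Chat₀ V) (hC : IsSpectralDensity C₀ Chat₀)
    (k : Sp d) :
    IsMode channels (modeWeight β Chat₀ k) α (fourierMode (2 * β * C₀ 0) V k) where
  initial r s := by
    rw [fourierMode_of_nonneg _ _ _ le_rfl, hV.initial]
    simp [character]
  continuous r s := by
    have h : ContinuousOn (fun τ => pairing (V τ r s) (character k)) (Ici 0) := fun τ hτ =>
      (hV.hasDerivWithinAt_pairing_character hτ r s k).continuousWithinAt
    have h2 : Continuous fun τ : ℝ => pairing (V (max τ 0) r s) (character k) :=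
      h.comp_continuous (f := fun τ : ℝ => max τ 0) (by fun_prop) fun τ => mem_Ici.mpr (le_max_right _ _)
    unfold fourierMode
    fun_prop
  measurable t :=
    (hV.measurable_pairing_character (le_max_right t 0) k).const_mul _
  bounded Z := by
    obtain ⟨M, hM⟩ := hV.exists_norm_pairing_character_le Z
    obtain ⟨N, hN⟩ := (isCompact_Icc (a := (0 : ℝ)) (b := Z)).exists_bound_of_continuousOn
      (f := fun t => (Real.exp (2 * β * C₀ 0 * t) : ℂ)) (Continuous.continuousOn (by fun_prop))
    refine ⟨N * M, fun t ht r s => ?_⟩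
    rw [fourierMode_of_nonneg _ _ _ ht.1, norm_mul]
    have := (norm_nonneg _).trans (hN t ht)
    gcongr
    exacts [hN t ht, hM t ht r s k]
  equation r s t ht := by
    have h1 : HasDerivAt (fun τ : ℝ => (Real.exp (2 * β * C₀ 0 * τ) : ℂ))
        ((Real.exp (2 * β * C₀ 0 * t) * (2 * β * C₀ 0) : ℝ) : ℂ) t := by
      have := (((hasDerivAt_id t).const_mul (2 * β * C₀ 0)).exp).ofReal_comp
      simpa using this
    have h2 := (hV.hasDerivWithinAt_pairing_character ht r s k).mono (Ici_subset_Ici.mpr ht)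
    have h3 := h1.hasDerivWithinAt.mul h2
    have hsub : ∀ τ ∈ Ici t, fourierMode (2 * β * C₀ 0) V k τ r s =
        (Real.exp (2 * β * C₀ 0 * τ) : ℂ) * pairing (V τ r s) (character k) := fun τ hτ =>
      fourierMode_of_nonneg _ _ _ (ht.trans hτ) r s
    refine (h3.congr hsub (hsub t self_mem_Ici)).congr_deriv ?_
    rw [hV.systemRHS_character hC ht]
    have hlin : ∀ j, ∫ u, (channels j).integrand (modeWeight β Chat₀ k) α t
        (fourierMode (2 * β * C₀ 0) V k t) r s u = (Real.exp (2 * β * C₀ 0 * t) : ℂ) *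
        ∫ u, (channels j).integrand (modeWeight β Chat₀ k) α t
          (fun r s => pairing (V t r s) (character k)) r s u := by
      intro j
      rw [← integral_const_mul]
      refine integral_congr_ae (.of_forall fun u => ?_)
      simp only [Channel.integrand, fourierMode_of_nonneg _ _ _ ht]
      ring
    simp only [hlin]
    rw [← Finset.mul_sum]
    push_cast
    ring

end IsSolution

/-! ### The layer symbol -/

section Symbol

variable {β : ℝ} {C₀ Chat₀ : Sp d → ℝ}

lemma IsSpectralDensity.continuous (hC : IsSpectralDensity C₀ Chat₀) : Continuous C₀ := by
  have h : Continuous fun x : Sp d => ∫ u : Sp d, (Chat₀ u : ℂ) * phase ⟪u, x⟫ := by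
    refine continuous_of_dominated (bound := fun u => ‖(Chat₀ u : ℂ)‖) (fun x => ?_)
      (fun x => .of_forall fun u => by simp) (hC.integrable.ofReal (𝕜 := ℂ)).norm
      (.of_forall fun u => by fun_prop)
    exact (hC.integrable.ofReal (𝕜 := ℂ)).aestronglyMeasurable.mul
      (Continuous.aestronglyMeasurable (by fun_prop))
  have h2 : Continuous fun x => (C₀ x : ℂ) := by
    simp only [hC.inversion]
    fun_prop
  exact Complex.continuous_re.comp h2

lemma IsSpectralDensity.exists_abs_le (hC : IsSpectralDensity C₀ Chat₀) :
    ∃ M, ∀ x, |C₀ x| ≤ M := by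
  refine ⟨‖((((2 * Real.pi) ^ d)⁻¹ : ℝ) : ℂ)‖ * ∫ u, ‖(Chat₀ u : ℂ)‖, fun x => ?_⟩
  rw [← Real.norm_eq_abs, ← Complex.norm_real, hC.inversion x, norm_mul]
  gcongr
  exact norm_integral_le_of_norm_le (hC.integrable.ofReal (𝕜 := ℂ)).norm
    (.of_forall fun u => by simp)

/-- The logarithmic time derivative of the layer symbol at frequency `k`. -/
noncomputable def symbolRate (β : ℝ) (C₀ : Sp d → ℝ) (r : Sp d) (t : ℝ) (k : Sp d) : ℝ :=
  β * (C₀ ((1 / 2 : ℝ) • k + t • r) + C₀ ((1 / 2 : ℝ) • k - t • r) - 2 * C₀ 0)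

lemma continuous_symbolRate (hC : IsSpectralDensity C₀ Chat₀) (r : Sp d) :
    Continuous fun p : ℝ × Sp d => symbolRate β C₀ r p.1 p.2 := by
  have := hC.continuous
  unfold symbolRate
  fun_prop

lemma layerSymbol_eq (r : Sp d) (t : ℝ) (k : Sp d) :
    layerSymbol β C₀ r t k = Real.exp (∫ τ in (0 : ℝ)..t, symbolRate β C₀ r τ k) := by
  simp only [layerSymbol, symbolRate, intervalIntegral.integral_const_mul]

lemma hasDerivAt_layerSymbol (hC : IsSpectralDensity C₀ Chat₀) (r : Sp d) (t : ℝ) (k : Sp d) :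
    HasDerivAt (fun τ => layerSymbol β C₀ r τ k)
      (layerSymbol β C₀ r t k * symbolRate β C₀ r t k) t := by
  have hc : Continuous fun τ => symbolRate β C₀ r τ k :=
    (continuous_symbolRate hC r).comp (f := fun τ : ℝ => (τ, k)) (by fun_prop)
  simp only [layerSymbol_eq]
  exact (hc.integral_hasStrictDerivAt 0 t).hasDerivAt.exp

lemma continuous_layerSymbol (hC : IsSpectralDensity C₀ Chat₀) (r : Sp d) (t : ℝ) :
    Continuous fun k => layerSymbol β C₀ r t k := by
  simp only [layerSymbol_eq]
  refine Real.continuous_exp.comp ?_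
  refine intervalIntegral.continuous_parametric_intervalIntegral_of_continuous' ?_ 0 t
  exact (continuous_symbolRate hC r).comp (f := fun p : Sp d × ℝ => (p.2, p.1)) (by fun_prop)

lemma exists_abs_symbolRate_le (hC : IsSpectralDensity C₀ Chat₀) (r : Sp d) :
    ∃ M, 0 ≤ M ∧ ∀ t k, |symbolRate β C₀ r t k| ≤ M := by
  obtain ⟨M, hM⟩ := hC.exists_abs_le
  have hM0 : 0 ≤ M := (abs_nonneg _).trans (hM 0)
  refine ⟨|β| * (4 * M), by positivity, fun t k => ?_⟩
  rw [symbolRate, abs_mul]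
  gcongr
  have h1 := abs_le.mp (hM ((1 / 2 : ℝ) • k + t • r))
  have h2 := abs_le.mp (hM ((1 / 2 : ℝ) • k - t • r))
  have h3 := abs_le.mp (hM 0)
  rw [abs_le]
  constructor <;> linarith

lemma exists_layerSymbol_le (hC : IsSpectralDensity C₀ Chat₀) (r : Sp d) :
    ∃ M, 0 ≤ M ∧ ∀ t k, layerSymbol β C₀ r t k ≤ Real.exp (M * |t|) := by
  obtain ⟨M, hM0, hM⟩ := exists_abs_symbolRate_le (β := β) hC r
  refine ⟨M, hM0, fun t k => ?_⟩
  rw [layerSymbol_eq, Real.exp_le_exp]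
  have := intervalIntegral.norm_integral_le_of_norm_le_const (a := 0) (b := t) (C := M)
    (f := fun τ => symbolRate β C₀ r τ k) fun τ _ => hM τ k
  rw [sub_zero] at this
  exact (le_abs_self _).trans this

/-- Both exponentials in `layerRate` are values of `C₀` by the spectral representation. -/
lemma layerRate_modeWeight (hC : IsSpectralDensity C₀ Chat₀) (k r : Sp d) (t : ℝ) :
    layerRate (modeWeight β Chat₀ k) r t =
      ((symbolRate β C₀ r t k + 2 * β * C₀ 0 : ℝ) : ℂ) := by
  have h : ∀ σ : ℝ, ∫ u, modeWeight β Chat₀ k u * phase (σ * ⟪r, u⟫ * t) =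
      β * C₀ ((1 / 2 : ℝ) • k + σ • t • r) := by
    intro σ
    rw [hC.inversion, ← mul_assoc, ← Complex.ofReal_mul, ← div_eq_mul_inv, ← integral_const_mul]
    refine integral_congr_ae (.of_forall fun u => ?_)
    simp only [modeWeight]
    rw [inner_add_right, real_inner_smul_right, real_inner_smul_right, real_inner_smul_right,
      phase_add, real_inner_comm k u, real_inner_comm r u, mul_comm t, ← mul_assoc σ]
    ring
  rw [layerRate, h, h, symbolRate]
  simp only [neg_smul, one_smul, ← sub_eq_add_neg]
  push_cast
  ring

lemma exp_mul_layerMode (hC : IsSpectralDensity C₀ Chat₀) (k r : Sp d) (t : ℝ) :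
    (Real.exp (-2 * β * C₀ 0 * t) : ℂ) * layerMode (modeWeight β Chat₀ k) r t =
      layerSymbol β C₀ r t k := by
  have hc : Continuous fun τ => symbolRate β C₀ r τ k :=
    (continuous_symbolRate hC r).comp (f := fun τ : ℝ => (τ, k)) (by fun_prop)
  simp only [layerMode, layerRate_modeWeight hC, layerSymbol_eq]
  rw [intervalIntegral.integral_ofReal, ← Complex.ofReal_exp, ← Complex.ofReal_mul,
    ← Real.exp_add, intervalIntegral.integral_add (hc.intervalIntegrable _ _) (by simp),
    intervalIntegral.integral_const]
  congr 2
  simp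
  ring

end Symbol

/-! ### Fourier inversion for test functions -/

/-- The Fourier transform `k ↦ ∫ e^{-i q·k} ψ(q) dq`, in the normalization of `layer`. -/
noncomputable def hat (ψ : Sp d → ℂ) (k : Sp d) : ℂ := ∫ q : Sp d, phase (-⟪q, k⟫) * ψ q

lemma hat_eq_fourier (ψ : 𝓢(Sp d, ℂ)) (k : Sp d) :
    hat ψ k = FourierTransform.fourier ψ ((2 * Real.pi)⁻¹ • k) := by
  rw [SchwartzMap.fourier_coe, Real.fourier_eq', hat]
  refine integral_congr_ae (.of_forall fun q => ?_)
  simp only [phase, smul_eq_mul]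
  rw [real_inner_smul_right]
  congr 4
  field_simp

lemma integrable_hat (ψ : 𝓢(Sp d, ℂ)) : Integrable (hat ψ) := by
  have h : hat ψ = fun k => FourierTransform.fourier ψ ((2 * Real.pi)⁻¹ • k) :=
    funext (hat_eq_fourier ψ)
  rw [h]
  exact (FourierTransform.fourier ψ : 𝓢(Sp d, ℂ)).integrable.comp_smul
    (inv_ne_zero Real.two_pi_pos.ne')

lemma inversion_hat (ψ : 𝓢(Sp d, ℂ)) (q : Sp d) :
    ((((2 * Real.pi) ^ d)⁻¹ : ℝ) : ℂ) * ∫ k, hat ψ k * character k q = ψ q := by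
  set G : Sp d → ℂ := fun ξ => Complex.exp (((2 * Real.pi * ⟪ξ, q⟫ : ℝ) : ℂ) * Complex.I) •
    (FourierTransform.fourier ψ : 𝓢(Sp d, ℂ)) ξ with hG
  have h1 : ∀ k, hat ψ k * character k q = G ((2 * Real.pi)⁻¹ • k) := by
    intro k
    simp only [hG, hat_eq_fourier, character, phase, smul_eq_mul]
    rw [mul_comm, real_inner_smul_left]
    congr 4
    field_simp
  have h2 : ψ q = ∫ ξ, G ξ := by
    rw [hG, ← Real.fourierInv_eq', ← SchwartzMap.fourierInv_coe, FourierPair.fourierInv_fourier_eq]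
  rw [integral_congr_ae (.of_forall h1), Measure.integral_comp_smul volume G, ← h2,
    finrank_euclideanSpace_fin, inv_pow, inv_inv,
    abs_of_pos (by positivity), Complex.real_smul, ← mul_assoc, ← Complex.ofReal_mul,
    inv_mul_cancel₀ (by positivity), Complex.ofReal_one, one_mul]

lemma hat_halfShift (ψ : Sp d → ℂ) (v k : Sp d) :
    hat (halfShift v ψ) k = phase ((1 / 2 : ℝ) * ⟪k, v⟫) * hat ψ k := by
  rw [hat, hat, ← integral_const_mul, ← integral_add_right_eq_self
    (fun q => phase ((1 / 2 : ℝ) * ⟪k, v⟫) * (phase (-⟪q, k⟫) * ψ q)) ((1 / 2 : ℝ) • v)]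
  refine integral_congr_ae (.of_forall fun q => ?_)
  simp only [halfShift]
  rw [← mul_assoc, ← phase_add, inner_add_left, real_inner_smul_left, real_inner_comm k v]
  congr 2
  ring

lemma layer_eq (β : ℝ) (C₀ : Sp d → ℝ) (r : Sp d) (t : ℝ) (ψ : Sp d → ℂ) :
    layer β C₀ r t ψ =
      ((((2 * Real.pi) ^ d)⁻¹ : ℝ) : ℂ) * ∫ k, hat ψ k * (layerSymbol β C₀ r t k : ℂ) := rfl

lemma pairing_eq_integral_hat (μ : ComplexMeasure (Sp d)) [IsFiniteMeasure μ.variation]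
    (ψ : 𝓢(Sp d, ℂ)) : pairing μ ψ =
      ((((2 * Real.pi) ^ d)⁻¹ : ℝ) : ℂ) * ∫ k, hat ψ k * pairing μ (character k) := by
  have h : (ψ : Sp d → ℂ) = fun q =>
      ∫ k, ((((2 * Real.pi) ^ d)⁻¹ : ℝ) : ℂ) * hat ψ k * character k q := by
    funext q
    rw [← inversion_hat ψ q, ← integral_const_mul]
    simp only [mul_assoc]
  conv_lhs => rw [h]
  rw [pairing_integral_character μ ((integrable_hat ψ).const_mul _), ← integral_const_mul]
  simp only [mul_assoc]

/-! ### The layer equation -/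

section Layer

variable {β : ℝ} {C₀ Chat₀ : Sp d → ℝ}

lemma integrable_hat_mul_layerSymbol (hC : IsSpectralDensity C₀ Chat₀) (r : Sp d) (t : ℝ)
    (ψ : 𝓢(Sp d, ℂ)) : Integrable fun k => hat ψ k * (layerSymbol β C₀ r t k : ℂ) := by
  obtain ⟨M, -, hM⟩ := exists_layerSymbol_le (β := β) hC r
  refine (integrable_hat ψ).mul_bdd (c := Real.exp (M * |t|)) ?_ (.of_forall fun k => ?_)
  · exact (Complex.continuous_ofReal.comp (continuous_layerSymbol hC r t)).aestronglyMeasurable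
  · rw [Complex.norm_real, layerSymbol, Real.norm_of_nonneg (Real.exp_nonneg _)]
    exact hM t k

lemma layer_zero (r : Sp d) (ψ : 𝓢(Sp d, ℂ)) : layer β C₀ r 0 ψ = ψ 0 := by
  rw [layer_eq, ← inversion_hat ψ 0]
  simp [layerSymbol, character]

lemma hasDerivAt_layer (hC : IsSpectralDensity C₀ Chat₀) (r : Sp d) (ψ : 𝓢(Sp d, ℂ)) (t : ℝ) :
    HasDerivAt (fun τ => layer β C₀ r τ ψ) (((((2 * Real.pi) ^ d)⁻¹ : ℝ) : ℂ) *
      ∫ k, hat ψ k * ((layerSymbol β C₀ r t k * symbolRate β C₀ r t k : ℝ) : ℂ)) t := by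
  obtain ⟨M, hM0, hM⟩ := exists_layerSymbol_le (β := β) hC r
  obtain ⟨N, hN0, hN⟩ := exists_abs_symbolRate_le (β := β) hC r
  simp only [layer_eq]
  refine HasDerivAt.const_mul _ ?_
  have hd := hasDerivAt_integral_of_dominated_loc_of_deriv_le (μ := (volume : Measure (Sp d)))
    (s := Metric.ball t 1) (x₀ := t)
    (F := fun τ k => hat ψ k * (layerSymbol β C₀ r τ k : ℂ))
    (F' := fun τ k => hat ψ k * ((layerSymbol β C₀ r τ k * symbolRate β C₀ r τ k : ℝ) : ℂ))
    (bound := fun k => ‖hat ψ k‖ * (Real.exp (M * (|t| + 1)) * N))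
    (Metric.ball_mem_nhds t one_pos) ?_ (integrable_hat_mul_layerSymbol hC r t ψ) ?_ ?_
    ((integrable_hat ψ).norm.mul_const _) ?_
  · exact hd.2
  · exact .of_forall fun τ => (integrable_hat_mul_layerSymbol hC r τ ψ).aestronglyMeasurable
  · refine (integrable_hat ψ).aestronglyMeasurable.mul (Continuous.aestronglyMeasurable ?_)
    have h1 := continuous_layerSymbol (β := β) hC r t
    have h2 : Continuous fun k => symbolRate β C₀ r t k :=
      (continuous_symbolRate hC r).comp (f := fun k : Sp d => (t, k)) (by fun_prop)
    fun_prop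
  · refine .of_forall fun k τ hτ => ?_
    rw [norm_mul, Complex.norm_real, norm_mul,
      Real.norm_of_nonneg (show 0 ≤ layerSymbol β C₀ r τ k from Real.exp_nonneg _)]
    have hτ' : |τ| ≤ |t| + 1 := by
      rw [Metric.mem_ball, Real.dist_eq] at hτ
      have := abs_sub_abs_le_abs_sub τ t
      linarith
    gcongr
    · refine (hM τ k).trans ?_
      gcongr
    · exact hN τ k
  · exact .of_forall fun k τ _ => (hasDerivAt_layerSymbol hC r τ k).ofReal_comp.const_mul _

/-- Spectral representation of the gain term of the layer equation. -/
lemma integral_cos_mul_phase (hC : IsSpectralDensity C₀ Chat₀) (r k : Sp d) (t : ℝ) :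
    ((((2 * Real.pi) ^ d)⁻¹ : ℝ) : ℂ) * ∫ v : Sp d, (Chat₀ v : ℂ) *
        (phase ((1 / 2 : ℝ) * ⟪k, v⟫) * (Real.cos (⟪r, v⟫ * t) : ℂ)) =
      ((1 / 2 * (C₀ ((1 / 2 : ℝ) • k + t • r) + C₀ ((1 / 2 : ℝ) • k - t • r)) : ℝ) : ℂ) := by
  have hi : ∀ x : Sp d, Integrable fun v : Sp d => (Chat₀ v : ℂ) * phase ⟪v, x⟫ := fun x =>
    (hC.integrable.ofReal (𝕜 := ℂ)).mul_bdd (c := 1)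
      (Continuous.aestronglyMeasurable (by fun_prop)) (.of_forall fun u => by simp)
  push_cast
  rw [hC.inversion, hC.inversion, ← mul_add, ← integral_add (hi _) (hi _), mul_left_comm]
  push_cast
  rw [← integral_const_mul (1 / 2 : ℂ)]
  congr 1
  refine integral_congr_ae (.of_forall fun v => ?_)
  have hcos : Complex.cos ((⟪r, v⟫ : ℂ) * (t : ℂ)) = (phase (⟪r, v⟫ * t) + phase (-(⟪r, v⟫ * t))) / 2 := by
    simp only [phase]
    push_cast
    exact Complex.cos.eq_1 _
  simp only
  rw [hcos, inner_add_right, inner_sub_right, real_inner_smul_right, real_inner_smul_right,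
    sub_eq_add_neg, phase_add, phase_add, real_inner_comm k v, real_inner_comm r v, mul_comm t]
  ring

/-- The layer profile solves its equation: its symbol has logarithmic derivative `symbolRate`, which
`integral_cos_mul_phase` turns into the gain and loss terms. -/
theorem isLayerSolution_layer (hC : IsSpectralDensity C₀ Chat₀) (r : Sp d) :
    IsLayerSolution β Chat₀ r (layer β C₀ r) where
  initial ψ := layer_zero r ψ
  equation ψ t _ := by
    refine (hasDerivAt_layer hC r ψ t).hasDerivWithinAt.congr_deriv ?_
    set S : Sp d → ℂ := fun k => hat ψ k * (layerSymbol β C₀ r t k : ℂ) with hS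
    have hSi : Integrable S := integrable_hat_mul_layerSymbol hC r t ψ
    have hCi : Integrable fun v : Sp d => (Chat₀ v : ℂ) := hC.integrable.ofReal
    set P : ℂ := ((((2 * Real.pi) ^ d)⁻¹ : ℝ) : ℂ) with hP
    -- the gain term, with the two integrations exchanged
    have hint : Integrable (fun p : Sp d × Sp d => (Chat₀ p.1 : ℂ) * (S p.2 *
        (phase ((1 / 2 : ℝ) * ⟪p.2, p.1⟫) * (Real.cos (⟪r, p.1⟫ * t) : ℂ))))
        ((volume : Measure (Sp d)).prod volume) := by
      have h1 : Integrable (fun p : Sp d × Sp d => (Chat₀ p.1 : ℂ) * S p.2)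
          ((volume : Measure (Sp d)).prod volume) := hCi.mul_prod hSi
      have h2 := h1.mul_bdd (c := 1) (g := fun p : Sp d × Sp d =>
        phase ((1 / 2 : ℝ) * ⟪p.2, p.1⟫) * (Real.cos (⟪r, p.1⟫ * t) : ℂ))
        (Continuous.aestronglyMeasurable (by fun_prop)) (.of_forall fun p => by
          rw [norm_mul, norm_phase, one_mul, Complex.norm_real]
          exact Real.abs_cos_le_one _)
      exact h2.congr (.of_forall fun p => by ring)
    have hgain : ∫ v : Sp d, (Chat₀ v : ℂ) *
          (layer β C₀ r t (halfShift v ψ) * (Real.cos (⟪r, v⟫ * t) : ℂ)) =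
        ∫ k, S k * ((1 / 2 * (C₀ ((1 / 2 : ℝ) • k + t • r) +
          C₀ ((1 / 2 : ℝ) • k - t • r)) : ℝ) : ℂ) := by
      simp only [← integral_cos_mul_phase hC, layer_eq, hat_halfShift]
      rw [← hP]
      calc _ = ∫ v, (∫ k, P * ((Chat₀ v : ℂ) * (S k *
            (phase ((1 / 2 : ℝ) * ⟪k, v⟫) * (Real.cos (⟪r, v⟫ * t) : ℂ))))) := by
            refine integral_congr_ae (.of_forall fun v => ?_)
            simp only
            rw [mul_assoc, mul_left_comm, ← integral_mul_const, ← integral_const_mul,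
              ← integral_const_mul]
            refine integral_congr_ae (.of_forall fun k => ?_)
            simp only [hS]
            ring
        _ = ∫ k, (∫ v, P * ((Chat₀ v : ℂ) * (S k *
            (phase ((1 / 2 : ℝ) * ⟪k, v⟫) * (Real.cos (⟪r, v⟫ * t) : ℂ))))) :=
            integral_integral_swap (hint.const_mul P)
        _ = _ := by
            refine integral_congr_ae (.of_forall fun k => ?_)
            simp only
            rw [← integral_const_mul, ← integral_const_mul]
            refine integral_congr_ae (.of_forall fun v => ?_)
            simp only
            ring
    have hgi : Integrable fun v : Sp d => (Chat₀ v : ℂ) *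
        (layer β C₀ r t (halfShift v ψ) * (Real.cos (⟪r, v⟫ * t) : ℂ)) := by
      refine (hint.integral_prod_left.const_mul P).congr (.of_forall fun v => ?_)
      simp only [layer_eq, hat_halfShift]
      rw [← hP, mul_assoc, mul_left_comm, ← integral_mul_const, ← integral_const_mul (Chat₀ v : ℂ)]
      congr 1
      refine integral_congr_ae (.of_forall fun k => ?_)
      simp only [hS]
      ring
    have h0 : (C₀ 0 : ℂ) = P * ∫ u : Sp d, (Chat₀ u : ℂ) := by
      simpa [hP] using hC.inversion 0
    have hki : Integrable fun k => S k * ((1 / 2 * (C₀ ((1 / 2 : ℝ) • k + t • r) +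
          C₀ ((1 / 2 : ℝ) • k - t • r)) : ℝ) : ℂ) := by
      obtain ⟨M, hM⟩ := hC.exists_abs_le
      have := hC.continuous
      refine hSi.mul_bdd (c := M) (Continuous.aestronglyMeasurable (by fun_prop))
        (.of_forall fun k => ?_)
      rw [Complex.norm_real, Real.norm_eq_abs, abs_le]
      have h1 := abs_le.mp (hM ((1 / 2 : ℝ) • k + t • r))
      have h2 := abs_le.mp (hM ((1 / 2 : ℝ) • k - t • r))
      constructor <;> linarith
    simp only [mul_sub]
    rw [integral_sub hgi (hCi.mul_const _), hgain, integral_mul_const, layer_eq]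
    have hc : ((2 * β / (2 * Real.pi) ^ d : ℝ) : ℂ) = 2 * β * P := by
      rw [hP, div_eq_mul_inv]; push_cast; ring
    rw [hc, ← hP]
    have e : ∫ k, hat ψ k * ((layerSymbol β C₀ r t k * symbolRate β C₀ r t k : ℝ) : ℂ) =
        2 * β * (∫ k, S k * ((1 / 2 * (C₀ ((1 / 2 : ℝ) • k + t • r) +
          C₀ ((1 / 2 : ℝ) • k - t • r)) : ℝ) : ℂ)) - 2 * β * C₀ 0 * ∫ k, S k := by
      rw [← integral_const_mul, ← integral_const_mul,
        ← integral_sub (hki.const_mul _) (hSi.const_mul _)]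
      refine integral_congr_ae (.of_forall fun k => ?_)
      simp only [hS, symbolRate]
      push_cast
      ring
    rw [e, h0]
    ring

end Layer

/-! ### Convergence of the measures -/

section Convergence

variable {β : ℝ} {C₀ Chat₀ : Sp d → ℝ} {V : ℝ → ℝ → Sp d → Sp d → ComplexMeasure (Sp d)}

open scoped Classical in
/-- The Fourier symbol of the limit at `(r + r₁/α, s + s₁/α)`. -/
noncomputable def limitSymbol (β : ℝ) (C₀ : Sp d → ℝ) (r₁ s₁ : Sp d) (t : ℝ) (r s k : Sp d) : ℂ :=
  (Real.exp (-2 * β * C₀ 0 * t) : ℂ) +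
    (if s = 0 then (layerSymbol β C₀ s₁ t k : ℂ) - (Real.exp (-2 * β * C₀ 0 * t) : ℂ) else 0) +
    (if r = 0 then (layerSymbol β C₀ r₁ t k : ℂ) - (Real.exp (-2 * β * C₀ 0 * t) : ℂ) else 0)

lemma exp_mul_limitMode (hC : IsSpectralDensity C₀ Chat₀) (r₁ s₁ : Sp d) (t : ℝ) (r s k : Sp d) :
    (Real.exp (-2 * β * C₀ 0 * t) : ℂ) * limitMode (modeWeight β Chat₀ k) r₁ s₁ t r s =
      limitSymbol β C₀ r₁ s₁ t r s k := by
  simp only [limitMode, limitSymbol, ← exp_mul_layerMode hC, mul_add, mul_ite, mul_sub, mul_one,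
    mul_zero]

/-- The limit in Fourier form: each mode converges by `tendsto_limitMode`, and the modes are bounded
uniformly in `α` and in the frequency `k`. -/
theorem tendsto_pairing_limitSymbol (hd : 0 < d) (hC : IsSpectralDensity C₀ Chat₀)
    (hV : ∀ α : ℝ, 0 < α → IsSolution α β Chat₀ (V α)) (r₁ s₁ : Sp d) {t : ℝ} (ht : 0 ≤ t)
    (r s : Sp d) (ψ : 𝓢(Sp d, ℂ)) :
    Tendsto (fun α : ℝ => pairing (V α t (r + α⁻¹ • r₁) (s + α⁻¹ • s₁)) ψ) atTop
      (𝓝 (((((2 * Real.pi) ^ d)⁻¹ : ℝ) : ℂ) *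
        ∫ k, hat ψ k * limitSymbol β C₀ r₁ s₁ t r s k)) := by
  have hpos : ∀ᶠ α : ℝ in atTop, 0 < α := eventually_gt_atTop 0
  have heq : (fun α : ℝ => pairing (V α t (r + α⁻¹ • r₁) (s + α⁻¹ • s₁)) ψ) =ᶠ[atTop]
      fun α => ((((2 * Real.pi) ^ d)⁻¹ : ℝ) : ℂ) *
        ∫ k, hat ψ k * pairing (V α t (r + α⁻¹ • r₁) (s + α⁻¹ • s₁)) (character k) := by
    filter_upwards [hpos] with α hα
    have := (hV α hα).isFiniteMeasure ht (r + α⁻¹ • r₁) (s + α⁻¹ • s₁)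
    exact pairing_eq_integral_hat _ ψ
  rw [tendsto_congr' heq]
  refine Tendsto.const_mul _ ?_
  have hmode : ∀ α, 0 < α → ∀ k r s, pairing (V α t r s) (character k) =
      (Real.exp (-2 * β * C₀ 0 * t) : ℂ) * fourierMode (2 * β * C₀ 0) (V α) k t r s := by
    intro α hα k r s
    rw [fourierMode_of_nonneg _ _ _ ht, ← mul_assoc, ← Complex.ofReal_mul, ← Real.exp_add]
    simp
  -- the growth rate of the modes does not depend on the frequency
  have hgrowth : ∀ k, growth (Fin 6) (modeWeight β Chat₀ k) =
      growth (Fin 6) (modeWeight β Chat₀ 0) := by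
    intro k
    simp only [growth, norm_modeWeight β Chat₀ k]
  refine tendsto_integral_filter_of_dominated_convergence (fun k => ‖hat ψ k‖ *
    (Real.exp (-2 * β * C₀ 0 * t) *
      (2 * Real.exp (2 * growth (Fin 6) (modeWeight β Chat₀ 0) * t)))) ?_ ?_
    ((integrable_hat ψ).norm.mul_const _) (.of_forall fun k => ?_)
  · filter_upwards [hpos] with α hα
    have := (hV α hα).isFiniteMeasure ht (r + α⁻¹ • r₁) (s + α⁻¹ • s₁)
    exact (integrable_hat ψ).aestronglyMeasurable.mul
      (continuous_pairing_character _).aestronglyMeasurable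
  · filter_upwards [hpos] with α hα
    refine .of_forall fun k => ?_
    rw [norm_mul, hmode α hα, norm_mul, Complex.norm_real,
      Real.norm_of_nonneg (Real.exp_nonneg _), ← hgrowth k]
    gcongr
    exact ((hV α hα).isMode_fourierMode hC k).norm_le (integrable_modeWeight hC.integrable k) ht _ _
  · refine Tendsto.const_mul _ ?_
    rw [← exp_mul_limitMode hC]
    have h := (tendsto_limitMode hd (integrable_modeWeight hC.integrable k)
      (fun α hα => (hV α hα).isMode_fourierMode hC k) r₁ s₁ ht r s).const_mul
      (Real.exp (-2 * β * C₀ 0 * t) : ℂ)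
    refine h.congr' ?_
    filter_upwards [hpos] with α hα
    rw [hmode α hα]

open scoped Classical in
/-- The limit at `(r + r₁/α, s + s₁/α)`: the ballistic delta, corrected by a profile in each of the
layers `s = 0` and `r = 0` that contains the point. -/
theorem tendsto_pairing (hd : 0 < d) (hC : IsSpectralDensity C₀ Chat₀)
    (hV : ∀ α : ℝ, 0 < α → IsSolution α β Chat₀ (V α)) (r₁ s₁ : Sp d) {t : ℝ} (ht : 0 ≤ t)
    (r s : Sp d) (ψ : 𝓢(Sp d, ℂ)) :
    Tendsto (fun α : ℝ => pairing (V α t (r + α⁻¹ • r₁) (s + α⁻¹ • s₁)) ψ) atTop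
      (𝓝 ((Real.exp (-2 * β * C₀ 0 * t) : ℂ) * ψ 0 +
        (if s = 0 then layer β C₀ s₁ t ψ - (Real.exp (-2 * β * C₀ 0 * t) : ℂ) * ψ 0 else 0) +
        (if r = 0 then layer β C₀ r₁ t ψ - (Real.exp (-2 * β * C₀ 0 * t) : ℂ) * ψ 0 else 0))) := by
  convert tendsto_pairing_limitSymbol hd hC hV r₁ s₁ ht r s ψ using 2
  have hψ : ψ 0 = ((((2 * Real.pi) ^ d)⁻¹ : ℝ) : ℂ) * ∫ k, hat ψ k := by
    simpa [character] using (inversion_hat ψ 0).symm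
  have hi := integrable_hat ψ
  have hS := fun r => integrable_hat_mul_layerSymbol (β := β) hC r t ψ
  set P : ℂ := ((((2 * Real.pi) ^ d)⁻¹ : ℝ) : ℂ) with hP
  set a : ℂ := (Real.exp (-2 * β * C₀ 0 * t) : ℂ) with ha
  have hone : ∀ (p : Prop) [Decidable p] (x : Sp d),
      Integrable (fun k => hat ψ k * (if p then (layerSymbol β C₀ x t k : ℂ) - a else 0)) ∧
      P * ∫ k, hat ψ k * (if p then (layerSymbol β C₀ x t k : ℂ) - a else 0) =
        if p then layer β C₀ x t ψ - a * ψ 0 else 0 := by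
    intro p _ x
    split_ifs
    · simp only [mul_sub]
      refine ⟨(hS x).sub (hi.mul_const a), ?_⟩
      rw [integral_sub (hS x) (hi.mul_const a), integral_mul_const, layer_eq, hψ]
      ring
    · simp
  simp only [limitSymbol, mul_add]
  have h12 : Integrable fun k => hat ψ k * a +
      hat ψ k * (if s = 0 then (layerSymbol β C₀ s₁ t k : ℂ) - a else 0) :=
    (hi.mul_const a).add (hone _ s₁).1
  rw [integral_add h12 (hone _ r₁).1,
    integral_add (hi.mul_const a) (hone _ s₁).1, mul_add, mul_add, (hone _ s₁).2, (hone _ r₁).2,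
    integral_mul_const, hψ]
  ring

end Convergence

end ReflectedWigner

theorem lemma4p1 {d : ℕ} (hd : 0 < d) (β : ℝ) (hβ : 0 < β)
    (C₀ Chat₀ : ReflectedWigner.Sp d → ℝ)
    (hC : ReflectedWigner.IsSpectralDensity C₀ Chat₀)
    (V : ℝ → ℝ → ReflectedWigner.Sp d → ReflectedWigner.Sp d →
      ComplexMeasure (ReflectedWigner.Sp d))
    (hV : ∀ α : ℝ, 0 < α → ReflectedWigner.IsSolution α β Chat₀ (V α)) :
    -- part (1)
    (∀ r s : ReflectedWigner.Sp d, r ≠ 0 → s ≠ 0 →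
      ∀ ζ : ℝ, 0 ≤ ζ → ∀ ψ : 𝓢(ReflectedWigner.Sp d, ℂ),
        Tendsto (fun α : ℝ => ReflectedWigner.pairing (V α ζ r s) ψ) atTop
          (𝓝 ((Real.exp (-2 * β * C₀ 0 * ζ) : ℂ) * ψ 0))) ∧
    -- part (2): the layer profile solves its equation, and is the limit in the two layers
    (∀ r : ReflectedWigner.Sp d,
      ReflectedWigner.IsLayerSolution β Chat₀ r (ReflectedWigner.layer β C₀ r)) ∧
    (∀ r s : ReflectedWigner.Sp d, s ≠ 0 →
      ∀ ζ : ℝ, 0 ≤ ζ → ∀ ψ : 𝓢(ReflectedWigner.Sp d, ℂ),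
        Tendsto (fun α : ℝ => ReflectedWigner.pairing (V α ζ (α⁻¹ • r) s) ψ) atTop
          (𝓝 (ReflectedWigner.layer β C₀ r ζ ψ))) ∧
    (∀ r s : ReflectedWigner.Sp d, r ≠ 0 →
      ∀ ζ : ℝ, 0 ≤ ζ → ∀ ψ : 𝓢(ReflectedWigner.Sp d, ℂ),
        Tendsto (fun α : ℝ => ReflectedWigner.pairing (V α ζ r (α⁻¹ • s)) ψ) atTop
          (𝓝 (ReflectedWigner.layer β C₀ s ζ ψ))) ∧
    -- part (3)
    (∀ r s : ReflectedWigner.Sp d,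
      ∀ ζ : ℝ, 0 ≤ ζ → ∀ ψ : 𝓢(ReflectedWigner.Sp d, ℂ),
        Tendsto (fun α : ℝ => ReflectedWigner.pairing (V α ζ (α⁻¹ • r) (α⁻¹ • s)) ψ) atTop
          (𝓝 (ReflectedWigner.layer β C₀ r ζ ψ + ReflectedWigner.layer β C₀ s ζ ψ
            - (Real.exp (-2 * β * C₀ 0 * ζ) : ℂ) * ψ 0))) := by
  classical
  have key := fun r₁ s₁ r s (ζ : ℝ) (hζ : 0 ≤ ζ) ψ =>
    ReflectedWigner.tendsto_pairing hd hC hV r₁ s₁ hζ r s ψ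
  refine ⟨fun r s hr hs ζ hζ ψ => ?_, fun r => ReflectedWigner.isLayerSolution_layer hC r,
    fun r s hs ζ hζ ψ => ?_, fun r s hr ζ hζ ψ => ?_, fun r s ζ hζ ψ => ?_⟩
  · simpa [hr, hs] using key 0 0 r s ζ hζ ψ
  · simpa [hs] using key r 0 0 s ζ hζ ψ
  · simpa [hr] using key 0 s r 0 ζ hζ ψ
  · have h := key r s 0 0 ζ hζ ψ
    simp only [if_true, zero_add] at h
    convert h using 2
    ring
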